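/- Let $d\ge 1$ and let $H:\mathbb R^d\times\mathbb R^d\to\mathbb R$, $(x,p)\mapsto H(x,p)$, and $G:\mathbb R^d\to\mathbb R$ be $C^2$ functions with uniformly bounded second order derivatives. Suppose that there is $L\in C^2(\mathbb R^d\times\mathbb R^d)$, with $L(x,\cdot)$ convex for every $x$, such that $$H(x,p)=\sup_{v\in\mathbb R^d}\{p\cdot v-L(x,-v)\}\qquad\text{for all }x,p\in\mathbb R^d .$$ For a square matrix $A$ write $\operatorname{Re}A=\frac12(A+A^\top)$, and for $x,p,w\in\mathbb R^d$ set $$a=w^\top\operatorname{Re}\partial_{xp}H(x,p)\,w,\qquad b=w^\top\partial_{xx}H(x,p)\,w,\qquad c=w^\top\partial_{pp}H(x,p)\,w .$$ Suppose that $a^2-bc\ge 0$ for all $w,x,p\in\mathbb R^d$. Let $$\alpha:=\inf_{x,p,\ |w|=1}\frac{a+\sqrt{a^2-bc}}{c},\qquad\text{and suppose}\qquad \alpha\ \ge\ \sup_{x,p,\ |w|=1}\frac{a-\sqrt{a^2-bc}}{c}$$ (infimum and supremum in $[-\infty,\infty]$; in particular $\alpha$ is then a real number). Suppose finally that $x\mapsto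 G(x)+\frac{\alpha}{2}|x|^2$ is convex. Then the problem $$-\partial_t u(t,x)+H(x,\partial_x u(t,x))=0\ \text{ in }(0,T)\times\mathbb R^d,\qquad u(T,x)=G(x)\ \text{ for }x\in\mathbb R^d,$$ is globally well-posed in the class $C^{1,1}_{\rm loc}([0,T]\times\mathbb R^d)$: for every $T>0$ it has exactly one solution $u$ that is $C^1$ on $[0,T]\times\mathbb R^d$ with derivative in $(t,x)$ locally Lipschitz there. Moreover, the function $H_\alpha(x,p):=H(x,p-\alpha x)$ is concave in $x$ for every $p$ and convex in $p$ for every $x$. -/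

import Mathlib

open scoped Matrix

noncomputable section

namespace HJB

/-- The Euclidean space `ℝ^d`. -/
abbrev E (d : ℕ) : Type := EuclideanSpace ℝ (Fin d)

variable {d : ℕ}

/-- The second derivative of `H : ℝ^d × ℝ^d → ℝ` at `(x, p)`, as a bilinear form on `ℝ^d × ℝ^d`. -/
def secondDeriv (H : E d → E d → ℝ) (x p : E d) : E d × E d →L[ℝ] E d × E d →L[ℝ] ℝ :=
  fderiv ℝ (fderiv ℝ (Function.uncurry H)) (x, p)

/-- The `i`-th standard basis vector of `ℝ^d`. -/
def stdVec (i : Fin d) : E d := EuclideanSpace.single i (1 : ℝ)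

/-- The matrix `∂_{xx} H(x,p)`. -/
def hessXX (H : E d → E d → ℝ) (x p : E d) : Matrix (Fin d) (Fin d) ℝ :=
  Matrix.of fun i j => secondDeriv H x p (stdVec i, 0) (stdVec j, 0)

/-- The matrix `∂_{xp} H(x,p)`, with entries `∂²H / ∂x_i ∂p_j`. -/
def hessXP (H : E d → E d → ℝ) (x p : E d) : Matrix (Fin d) (Fin d) ℝ :=
  Matrix.of fun i j => secondDeriv H x p (stdVec i, 0) (0, stdVec j)

/-- The matrix `∂_{pp} H(x,p)`. -/
def hessPP (H : E d → E d → ℝ) (x p : E d) : Matrix (Fin d) (Fin d) ℝ :=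
  Matrix.of fun i j => secondDeriv H x p (0, stdVec i) (0, stdVec j)

/-- The symmetric part `Re A = (A + Aᵀ) / 2` of a square matrix. -/
def symPart (A : Matrix (Fin d) (Fin d) ℝ) : Matrix (Fin d) (Fin d) ℝ :=
  (1 / 2 : ℝ) • (A + Aᵀ)

/-- The number `wᵀ A w`. -/
def quad (A : Matrix (Fin d) (Fin d) ℝ) (w : E d) : ℝ :=
  w.ofLp ⬝ᵥ (A *ᵥ w.ofLp)

/-- `(wᵀ Re ∂_{xp}H w)² - (wᵀ ∂_{pp}H w) (wᵀ ∂_{xx}H w)` at `(x, p)`. -/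
def disc (H : E d → E d → ℝ) (x p w : E d) : ℝ :=
  quad (symPart (hessXP H x p)) w ^ 2 - quad (hessPP H x p) w * quad (hessXX H x p) w

/-- The larger root `r` of `(wᵀ ∂_{pp}H w) r² - 2 (wᵀ Re ∂_{xp}H w) r + wᵀ ∂_{xx}H w`. -/
def largerRoot (H : E d → E d → ℝ) (x p w : E d) : ℝ :=
  (quad (symPart (hessXP H x p)) w + √(disc H x p w)) / quad (hessPP H x p) w

/-- The smaller root of the same quadratic polynomial. -/
def smallerRoot (H : E d → E d → ℝ) (x p w : E d) : ℝ :=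
  (quad (symPart (hessXP H x p)) w - √(disc H x p w)) / quad (hessPP H x p) w

/-- Infimum of the larger root over all `x`, `p` and unit vectors `w`, in the extended reals. -/
def infLargerRoot (H : E d → E d → ℝ) : EReal :=
  ⨅ (x : E d) (p : E d) (w : E d) (_ : ‖w‖ = 1), (largerRoot H x p w : EReal)

/-- Supremum of the smaller root over all `x`, `p` and unit vectors `w`, in the extended reals. -/
def supSmallerRoot (H : E d → E d → ℝ) : EReal :=
  ⨆ (x : E d) (p : E d) (w : E d) (_ : ‖w‖ = 1), (smallerRoot H x p w : EReal)

/-- A twice continuously differentiable function with uniformly bounded second derivative. -/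
def IsC2Bounded {F : Type*} [NormedAddCommGroup F] [NormedSpace ℝ F] (f : F → ℝ) : Prop :=
  ContDiff ℝ 2 f ∧ ∃ C : ℝ, ∀ z, ‖fderiv ℝ (fderiv ℝ f) z‖ ≤ C

/-- `H(x,p) = sup_v { p · v - L(x,-v) }`, the supremum being finite. -/
def IsHamiltonianOf (H L : E d → E d → ℝ) : Prop :=
  ∀ x p, IsLUB (Set.range fun v : E d => inner ℝ p v - L x (-v)) (H x p)

/-- The transformed Hamiltonian `H_α(x,p) = H(x, p - α x)`. -/
def transH (H : E d → E d → ℝ) (α : ℝ) (x p : E d) : ℝ := H x (p - α • x)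

/-- The transformed final datum `G_α(x) = G(x) + α |x|² / 2`. -/
def transG (G : E d → ℝ) (α : ℝ) (x : E d) : ℝ := G x + α / 2 * ‖x‖ ^ 2

/-- The closed strip `[0,T] × ℝ^d`. -/
def strip (d : ℕ) (T : ℝ) : Set (ℝ × E d) := Set.Icc 0 T ×ˢ Set.univ

/-- The class `C^{1,1}_loc([0,T] × ℝ^d)`: continuously differentiable up to the boundary, with
locally Lipschitz derivative in `(t,x)`. -/
def IsC11loc (T : ℝ) (u : ℝ → E d → ℝ) : Prop :=
  ContDiffOn ℝ 1 (Function.uncurry u) (strip d T) ∧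
    LocallyLipschitzOn (strip d T) (fderivWithin ℝ (Function.uncurry u) (strip d T))

/-- `u` solves `-∂_t u + H(x, ∂_x u) = 0` in `(0,T) × ℝ^d` with `u(T,·) = G`. -/
def SolvesHJB (H : E d → E d → ℝ) (G : E d → ℝ) (T : ℝ) (u : ℝ → E d → ℝ) : Prop :=
  (∀ t ∈ Set.Ioo 0 T, ∀ x : E d, -deriv (fun s => u s x) t + H x (gradient (u t) x) = 0) ∧
    ∀ x, u T x = G x

/-- For every time horizon `T > 0`, there is a solution in `C^{1,1}_loc([0,T] × ℝ^d)`, and it is the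
only one in this class. -/
def GloballyWellPosed (H : E d → E d → ℝ) (G : E d → ℝ) : Prop :=
  ∀ T : ℝ, 0 < T → ∃ u : ℝ → E d → ℝ, (IsC11loc T u ∧ SolvesHJB H G T u) ∧
    ∀ v : ℝ → E d → ℝ, IsC11loc T v → SolvesHJB H G T v →
      ∀ t ∈ Set.Icc 0 T, ∀ x, v t x = u t x

end HJB

end

namespace HJB

open Set Filter Topology
open scoped NNReal

/-! ### Ordinary differential equations -/

/-! Put s = T - t. The equation becomes ∂ₛu + H(x, ∂ₓu) = 0, with characteristics ẋ = ∂ₚH, ṗ = -∂ₓH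
issued from (y, ∇G(y)). Bounded second derivatives make these curves global in time, so the only
obstruction to a classical solution is that their positions may cross. Crossing has to be excluded
on [0, T] for every T.

Since H(x, ·) is the conjugate of a C² function, c > 0 for w ≠ 0 (`sndDeriv_momentum_pos`). A number
α between the two roots then satisfies b - 2αa + α²c ≤ 0, that is, D²H ≤ 0 on the directions (w,
-αw) (`sndDeriv_shifted_nonpos`). This is the concavity of H_α in x; its convexity in p is that of
H.

For two characteristics let x be the difference of positions, δp that of momenta, and w = δp + αx.
The concave-convex structure makes ⟨w, x⟩ nondecreasing, but its sign alone does not prevent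
crossing. The quantity ⟨w, x⟩ - ε|w|², with ε = ε₀e^(-Λs), is nondecreasing as well
(`saddle_estimate`), and it is nonnegative at s = 0 because the gradient of the convex function G_α
is cocoercive (`cocoercive_of_convex`). Hence ε|w| ≤ |x|, which gives |δp| ≤ K|x| on [0, T]
(`momentum_estimate`).

This bound makes the position maps y ↦ x(s) bijective with Lipschitz inverses
(`IsCharField.surjective`). The action carried along the characteristics is therefore a function of
(s, x); its spatial gradient is the transported momentum (`IsCharField.hasFDerivWithinAt_value`),
which is locally Lipschitz. That is existence.

For uniqueness, the gradient Q of another solution is only Lipschitz, so the equation cannot be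
differentiated in x. Finite increments and Gronwall show instead that Q follows the characteristics
(`IsLipSolution.gradient_eq_of_characteristic`). The curve through any interior point then ends on
the graph of ∇G and is one of those above, and the values agree along it (`IsCharField.eq_value`).
-/

/-- A `C¹`, globally Lipschitz vector field has global integral curves. -/
theorem exists_global_integralCurve {Z : Type*} [NormedAddCommGroup Z] [NormedSpace ℝ Z]
    [CompleteSpace Z] {F : Z → Z} {K : ℝ≥0} (hF : LipschitzWith K F) (hC : ContDiff ℝ 1 F) (z : Z) :
    ∃ γ : ℝ → Z, γ 0 = z ∧ ∀ t, HasDerivAt γ (F (γ t)) t := by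
  have hε : (0 : ℝ) < 1 / (K + 1) := by positivity
  have hloc : ∀ y : Z, ∃ γ : ℝ → Z, γ 0 = y ∧
      ∀ t ∈ Ioo (-(1 / ((K : ℝ) + 1))) (1 / (K + 1)), HasDerivAt γ (F (γ t)) t := by
    intro y
    -- On the ball of radius ‖F y‖ about y the field is at most (K + 1)‖F y‖, so curves stay inside
    -- for time 1/(K + 1). This time does not depend on y, which is what allows local curves to be
    -- glued into a global one.
    have hPL : IsPicardLindelof (fun _ => F) (tmin := -(1 / ((K : ℝ) + 1)))
        (tmax := 1 / ((K : ℝ) + 1)) ⟨0, by constructor <;> linarith⟩ y ‖F y‖₊ 0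
        ((K + 1) * ‖F y‖₊) K := by
      refine ⟨fun _ _ => hF.lipschitzOnWith, fun _ _ => continuousOn_const, ?_, ?_⟩
      · intro _ _ x hx
        have h1 := hF.dist_le_mul x y
        rw [Metric.mem_closedBall] at hx
        have h2 : ‖F x‖ ≤ ‖F y‖ + dist (F x) (F y) := by
          rw [dist_eq_norm]; simpa using norm_add_le (F y) (F x - F y)
        have h3 : (K : ℝ) * dist x y ≤ K * ‖F y‖ := by
          apply mul_le_mul_of_nonneg_left _ K.coe_nonneg
          simpa using hx
        push_cast
        linarith
      · simp only [sub_zero, zero_sub, neg_neg, max_self]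
        push_cast
        apply le_of_eq
        field_simp
        simp
    obtain ⟨γ, h0, hγ⟩ := hPL.exists_eq_forall_mem_Icc_hasDerivWithinAt₀
    exact ⟨γ, h0, fun t ht => (hγ t (Ioo_subset_Icc_self ht)).hasDerivAt (Icc_mem_nhds ht.1 ht.2)⟩
  have hC' : ContMDiff (modelWithCornersSelf ℝ Z) (modelWithCornersSelf ℝ Z).tangent 1
      (fun x => (⟨x, F x⟩ : TangentBundle (modelWithCornersSelf ℝ Z) Z)) :=
    contMDiff_vectorSpace_iff_contDiff.2 hC
  obtain ⟨γ, h0, hγ⟩ := exists_isMIntegralCurve_of_isMIntegralCurveOn (I := modelWithCornersSelf ℝ Z)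
    (v := F) hC' hε (fun y => by
      obtain ⟨γ, h0, hγ⟩ := hloc y
      exact ⟨γ, h0, fun t ht => (hγ t ht).hasFDerivAt.hasMFDerivAt.hasMFDerivWithinAt⟩) z
  refine ⟨γ, h0, fun t => ?_⟩
  have ht := hasMFDerivAt_iff_hasFDerivAt.1 (hγ t)
  exact hasDerivAt_iff_hasFDerivAt.2 ht

/-- Exponential dependence of integral curves on the initial position, in both time directions. -/
theorem norm_integralCurve_sub_le {Z : Type*} [NormedAddCommGroup Z] [NormedSpace ℝ Z]
    {F : Z → Z} {K : ℝ≥0} (hF : LipschitzWith K F) {γ₁ γ₂ : ℝ → Z}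
    (h₁ : ∀ t, HasDerivAt γ₁ (F (γ₁ t)) t) (h₂ : ∀ t, HasDerivAt γ₂ (F (γ₂ t)) t) (s t : ℝ) :
    ‖γ₁ t - γ₂ t‖ ≤ ‖γ₁ s - γ₂ s‖ * Real.exp (K * |t - s|) := by
  have key : ∀ {F : Z → Z}, LipschitzWith K F → ∀ {γ₁ γ₂ : ℝ → Z},
      (∀ t, HasDerivAt γ₁ (F (γ₁ t)) t) → (∀ t, HasDerivAt γ₂ (F (γ₂ t)) t) → ∀ s t : ℝ, s ≤ t →
      ‖γ₁ t - γ₂ t‖ ≤ ‖γ₁ s - γ₂ s‖ * Real.exp (K * (t - s)) := by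
    intro F hF γ₁ γ₂ h₁ h₂ s t hst
    have := dist_le_of_trajectories_ODE (v := fun _ => F) (a := s) (b := t) (δ := dist (γ₁ s) (γ₂ s))
      (fun _ => hF)
      (fun τ _ => (h₁ τ).continuousAt.continuousWithinAt) (fun τ _ => (h₁ τ).hasDerivWithinAt)
      (fun τ _ => (h₂ τ).continuousAt.continuousWithinAt) (fun τ _ => (h₂ τ).hasDerivWithinAt)
      le_rfl t ⟨hst, le_rfl⟩
    simpa only [dist_eq_norm] using this
  rcases le_total s t with hst | hst
  · rw [abs_of_nonneg (sub_nonneg.2 hst)]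
    exact key hF h₁ h₂ s t hst
  · rw [abs_of_nonpos (sub_nonpos.2 hst)]
    have hrev : ∀ {γ : ℝ → Z}, (∀ t, HasDerivAt γ (F (γ t)) t) →
        ∀ t, HasDerivAt (fun τ => γ (-τ)) (-F (γ (-t))) t := by
      intro γ hγ t
      simpa [Function.comp_def] using (hγ (-t)).scomp t (hasDerivAt_neg t)
    have := key (F := fun z => -F z) hF.neg (hrev h₁) (hrev h₂) (-s) (-t) (neg_le_neg hst)
    simp only [neg_neg] at this
    convert this using 3
    ring

/-! ### Surjectivity along a path of maps -/

/-- If `f 0 = id`, the maps `f s` are uniformly antilipschitz, and `f s' - f s` has Lipschitz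
constant `C |s' - s|`, then every `f s` is onto. -/
theorem surjective_of_antilipschitz_path {V : Type*} [NormedAddCommGroup V] [CompleteSpace V]
    {f : ℝ → V → V} {T A C : ℝ} (hA : 0 < A) (hC : 0 < C) (h0 : ∀ y, f 0 y = y)
    (hanti : ∀ s ∈ Icc 0 T, ∀ y y', ‖y - y'‖ ≤ A * ‖f s y - f s y'‖)
    (hlip : ∀ s ∈ Icc 0 T, ∀ s' ∈ Icc 0 T, ∀ y y',
      ‖(f s' y - f s y) - (f s' y' - f s y')‖ ≤ C * |s' - s| * ‖y - y'‖) :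
    ∀ s ∈ Icc 0 T, Function.Surjective (f s) := by
  have hAC : 0 < A * C := mul_pos hA hC
  -- For |s' - s| ≤ r the perturbation f s' - f s, read through a right inverse of f s, has
  -- Lipschitz constant at most A * C * r = 1/2.
  set r : ℝ := 1 / (2 * (A * C)) with hr
  have hrpos : 0 < r := by positivity
  have step : ∀ s ∈ Icc 0 T, ∀ s' ∈ Icc 0 T, |s' - s| ≤ r → Function.Surjective (f s) →
      Function.Surjective (f s') := by
    intro s hs s' hs' hd hsurj η
    obtain ⟨g, hg⟩ := hsurj.hasRightInverse
    have hcontr : ContractingWith (1 / 2 : ℝ≥0) (fun ξ => η - (f s' (g ξ) - f s (g ξ))) := by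
      refine ⟨by norm_num, LipschitzWith.of_dist_le_mul fun ξ ξ' => ?_⟩
      rw [dist_sub_left, dist_eq_norm, dist_eq_norm]
      have h1 := hlip s hs s' hs' (g ξ) (g ξ')
      have h2 := hanti s hs (g ξ) (g ξ')
      rw [hg ξ, hg ξ'] at h2
      have h3 : C * |s' - s| * ‖g ξ - g ξ'‖ ≤ C * r * (A * ‖ξ - ξ'‖) := by gcongr
      have h4 : C * r * (A * ‖ξ - ξ'‖) = 1 / 2 * ‖ξ - ξ'‖ := by
        rw [hr]; field_simp
      have h5 : (((1 / 2 : ℝ≥0) : ℝ)) = 1 / 2 := by simp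
      rw [h5]; linarith
    -- As f s (g ξ) = ξ, a fixed point ξ satisfies f s' (g ξ) = η.
    have hfix : η - (f s' (g hcontr.fixedPoint) - f s (g hcontr.fixedPoint)) = hcontr.fixedPoint :=
      hcontr.fixedPoint_isFixedPt
    refine ⟨g hcontr.fixedPoint, ?_⟩
    rw [hg] at hfix
    generalize hcontr.fixedPoint = ξ at hfix ⊢
    calc f s' (g ξ) = η - (η - (f s' (g ξ) - ξ)) + ξ := by abel
      _ = η := by rw [hfix]; abel
  have hind : ∀ n : ℕ, ∀ s ∈ Icc 0 T, s ≤ n * r → Function.Surjective (f s) := by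
    intro n
    induction n with
    | zero =>
      intro s hs hsn
      have : s = 0 := le_antisymm (by simpa using hsn) hs.1
      subst this
      exact fun y => ⟨y, h0 y⟩
    | succ n ih =>
      intro s hs hsn
      push_cast at hsn
      by_cases hle : s ≤ r
      · exact step 0 ⟨le_rfl, hs.1.trans hs.2⟩ s hs (by rwa [sub_zero, abs_of_nonneg hs.1])
          (fun y => ⟨y, h0 y⟩)
      · push Not at hle
        have hm : s - r ∈ Icc 0 T := ⟨by linarith, by linarith [hs.2]⟩
        refine step (s - r) hm s hs ?_ (ih _ hm (by linarith))
        rw [sub_sub_cancel, abs_of_pos hrpos]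
  intro s hs
  obtain ⟨n, hn⟩ := exists_nat_ge (s / r)
  exact hind n s hs ((div_le_iff₀ hrpos).1 hn)

/-! ### Hamiltonian characteristics -/

/-- Second order remainder of a function with Lipschitz derivative. -/
theorem abs_sub_sub_le_of_lipschitz_deriv {W : Type*} [NormedAddCommGroup W] [NormedSpace ℝ W]
    {f : W → ℝ} {f' : W → W →L[ℝ] ℝ} {C : ℝ} {z z' : W}
    (hf : ∀ w ∈ segment ℝ z z', HasFDerivAt f (f' w) w) (hC : 0 ≤ C)
    (hl : ∀ w ∈ segment ℝ z z', ‖f' w - f' z‖ ≤ C * ‖w - z‖) :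
    |f z' - f z - f' z (z' - z)| ≤ C * ‖z' - z‖ ^ 2 := by
  have := (convex_segment z z').norm_image_sub_le_of_norm_hasFDerivWithin_le' (f := f) (f' := f')
    (φ := f' z) (C := C * ‖z' - z‖) (fun w hw => (hf w hw).hasFDerivWithinAt)
    (fun w hw => (hl w hw).trans (mul_le_mul_of_nonneg_left ?_ hC))
    (left_mem_segment ℝ z z') (right_mem_segment ℝ z z')
  · rw [Real.norm_eq_abs] at this
    linarith [this, sq (‖z' - z‖), mul_assoc C ‖z' - z‖ ‖z' - z‖]
  · obtain ⟨θ, hθ, rfl⟩ := (segment_eq_image' ℝ z z') ▸ hw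
    simp only [add_sub_cancel_left, norm_smul, Real.norm_eq_abs, abs_of_nonneg hθ.1]
    exact mul_le_of_le_one_left (norm_nonneg _) hθ.2

section Characteristics

variable {V : Type*} [NormedAddCommGroup V] [InnerProductSpace ℝ V]

/-- The linear form `(a, b) ↦ ⟨u, a⟩ + ⟨v, b⟩` on `V × V`. -/
noncomputable def pairForm (u v : V) : V × V →L[ℝ] ℝ :=
  (innerSL ℝ u).comp (ContinuousLinearMap.fst ℝ V V) +
    (innerSL ℝ v).comp (ContinuousLinearMap.snd ℝ V V)

@[simp] theorem pairForm_apply (u v : V) (w : V × V) :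
    pairForm u v w = inner ℝ u w.1 + inner ℝ v w.2 := rfl

theorem norm_pairForm_sub_le (u v u' v' : V) :
    ‖pairForm u v - pairForm u' v'‖ ≤ ‖u - u'‖ + ‖v - v'‖ := by
  refine ContinuousLinearMap.opNorm_le_bound _ (by positivity) fun w => ?_
  have h1 : (pairForm u v - pairForm u' v') w = inner ℝ (u - u') w.1 + inner ℝ (v - v') w.2 := by
    simp [inner_sub_left]; ring
  rw [h1, add_mul]
  refine (norm_add_le _ _).trans (add_le_add ?_ ?_)
  · exact (norm_inner_le_norm _ _).trans (by gcongr; exact norm_fst_le w)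
  · exact (norm_inner_le_norm _ _).trans (by gcongr; exact norm_snd_le w)

/-- `h` has the partial gradients `hx`, `hp`, which are `M`-Lipschitz. -/
structure IsLipHamiltonian (h : V × V → ℝ) (hx hp : V × V → V) (M : ℝ≥0) : Prop where
  hasFDerivAt : ∀ z, HasFDerivAt h (pairForm (hx z) (hp z)) z
  lip_x : LipschitzWith M hx
  lip_p : LipschitzWith M hp

/-- The curve `γ` solves Hamilton's equations `ẋ = hp`, `ṗ = -hx`. -/
def IsCharacteristic (hx hp : V × V → V) (γ : ℝ → V × V) : Prop :=
  ∀ s, HasDerivAt γ (hp (γ s), -hx (γ s)) s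

theorem IsCharacteristic.hasDerivAt_fst {hx hp : V × V → V} {γ : ℝ → V × V}
    (hγ : IsCharacteristic hx hp γ) (s : ℝ) : HasDerivAt (fun s => (γ s).1) (hp (γ s)) s :=
  (ContinuousLinearMap.fst ℝ V V).hasFDerivAt.comp_hasDerivAt s (hγ s)

theorem IsCharacteristic.hasDerivAt_snd {hx hp : V × V → V} {γ : ℝ → V × V}
    (hγ : IsCharacteristic hx hp γ) (s : ℝ) : HasDerivAt (fun s => (γ s).2) (-hx (γ s)) s :=
  (ContinuousLinearMap.snd ℝ V V).hasFDerivAt.comp_hasDerivAt s (hγ s)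

theorem IsCharacteristic.continuous {hx hp : V × V → V} {γ : ℝ → V × V}
    (hγ : IsCharacteristic hx hp γ) : Continuous γ :=
  continuous_iff_continuousAt.2 fun s => (hγ s).continuousAt

namespace IsLipHamiltonian

variable {h : V × V → ℝ} {hx hp : V × V → V} {M : ℝ≥0}

theorem remainder (hh : IsLipHamiltonian h hx hp M) (z z' : V × V) :
    |h z' - h z - inner ℝ (hx z) (z'.1 - z.1) - inner ℝ (hp z) (z'.2 - z.2)| ≤
      2 * M * ‖z' - z‖ ^ 2 := by
  have := abs_sub_sub_le_of_lipschitz_deriv (f := h) (f' := fun z => pairForm (hx z) (hp z))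
    (C := 2 * M) (z := z) (z' := z') (fun w _ => hh.hasFDerivAt w) (by positivity) (fun w _ => by
      have h1 := hh.lip_x.norm_sub_le w z
      have h2 := hh.lip_p.norm_sub_le w z
      linarith [norm_pairForm_sub_le (hx w) (hp w) (hx z) (hp z)])
  simpa [sub_sub, add_assoc] using this

theorem lipschitz_field (hh : IsLipHamiltonian h hx hp M) :
    LipschitzWith M fun z => (hp z, -hx z) := by
  have := hh.lip_p.prodMk hh.lip_x.neg
  rwa [max_self] at this

end IsLipHamiltonian

/-- The characteristics `Γ y` of `h` issued from the points `(y, g y)` of the graph of the gradient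
`g` of `G`, with the actions `S y` along them, in the situation where the momentum difference of two
such characteristics is controlled by their distance on `[0, T]`. -/
structure IsCharField (h : V × V → ℝ) (hx hp : V × V → V) (M : ℝ≥0) (G : V → ℝ) (g : V → V)
    (N : ℝ≥0) (T K : ℝ) (Γ : V → ℝ → V × V) (S : V → ℝ → ℝ) : Prop
    extends IsLipHamiltonian h hx hp M where
  hasFDerivAt_init : ∀ y, HasFDerivAt G (innerSL ℝ (g y)) y
  lip_g : LipschitzWith N g
  init : ∀ y, Γ y 0 = (y, g y)
  char : ∀ y, IsCharacteristic hx hp (Γ y)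
  action_init : ∀ y, S y 0 = G y
  action_deriv : ∀ y s, HasDerivAt (S y) (inner ℝ (Γ y s).2 (hp (Γ y s)) - h (Γ y s)) s
  one_le : 1 ≤ K
  est : ∀ s ∈ Icc 0 T, ∀ y y', ‖(Γ y s).2 - (Γ y' s).2‖ ≤ K * ‖(Γ y s).1 - (Γ y' s).1‖

/-- The starting point of the characteristic that is at `x` at time `s`. -/
noncomputable def footpoint (Γ : V → ℝ → V × V) (s : ℝ) (x : V) : V :=
  Function.invFun (fun y => (Γ y s).1) x

/-- The action transported along the characteristics. -/
noncomputable def value (Γ : V → ℝ → V × V) (S : V → ℝ → ℝ) (s : ℝ) (x : V) : ℝ :=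
  S (footpoint Γ s x) s

/-- The momentum transported along the characteristics. -/
noncomputable def momentum (Γ : V → ℝ → V × V) (s : ℝ) (x : V) : V :=
  (Γ (footpoint Γ s x) s).2

namespace IsCharField

variable {h : V × V → ℝ} {hx hp : V × V → V} {M : ℝ≥0} {G : V → ℝ} {g : V → V} {N : ℝ≥0} {T K : ℝ}
  {Γ : V → ℝ → V × V} {S : V → ℝ → ℝ}

theorem norm_sub_le_exp (H : IsCharField h hx hp M G g N T K Γ S) {s τ : ℝ} (hs : s ∈ Icc 0 T)
    (hτ : τ ∈ Icc 0 T) (y y' : V) :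
    ‖Γ y τ - Γ y' τ‖ ≤ Real.exp (M * T) * ‖Γ y s - Γ y' s‖ := by
  have h1 := norm_integralCurve_sub_le H.lipschitz_field (H.char y) (H.char y') s τ
  have h2 : |τ - s| ≤ T := abs_le.2 ⟨by linarith [hs.2, hτ.1], by linarith [hs.1, hτ.2]⟩
  rw [mul_comm]
  exact h1.trans (by gcongr)

/-- Quantitative absence of crossing: the position gap at one time dominates the whole phase-space
gap there by `est`, and the Lipschitz flow carries this to every other time, backwards included. -/
theorem norm_sub_le (H : IsCharField h hx hp M G g N T K Γ S) {s τ : ℝ} (hs : s ∈ Icc 0 T)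
    (hτ : τ ∈ Icc 0 T) (y y' : V) :
    ‖Γ y τ - Γ y' τ‖ ≤ Real.exp (M * T) * K * ‖(Γ y s).1 - (Γ y' s).1‖ := by
  have h1 := H.norm_sub_le_exp hs hτ y y'
  have h2 : ‖Γ y s - Γ y' s‖ ≤ K * ‖(Γ y s).1 - (Γ y' s).1‖ := by
    rw [Prod.norm_def]
    refine max_le ?_ (H.est s hs y y')
    exact le_mul_of_one_le_left (norm_nonneg _) H.one_le
  rw [mul_assoc]
  exact h1.trans (by gcongr)

theorem surjective [CompleteSpace V] (H : IsCharField h hx hp M G g N T K Γ S) (hT : 0 ≤ T) :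
    ∀ s ∈ Icc 0 T, Function.Surjective fun y => (Γ y s).1 := by
  have h0 : (0 : ℝ) ∈ Icc 0 T := ⟨le_rfl, hT⟩
  have hK : 0 < K := zero_lt_one.trans_le H.one_le
  -- At s = 0 the position map is the identity. `A` comes from flowing back to time 0; `M + 1`
  -- replaces `M` in `C` only to keep it positive.
  refine surjective_of_antilipschitz_path (f := fun s y => (Γ y s).1) (T := T)
    (A := Real.exp (M * T) * K) (C := (M + 1) * (Real.exp (M * T) * (1 + N))) (by positivity)
    (by positivity) (fun y => by simp [H.init]) ?_ ?_
  · intro s hs y y'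
    refine le_trans ?_ (H.norm_sub_le hs h0 y y')
    rw [H.init, H.init]
    exact norm_fst_le ((y, g y) - (y', g y'))
  · intro s hs s' hs' y y'
    have hinit : ‖Γ y 0 - Γ y' 0‖ ≤ (1 + N) * ‖y - y'‖ := by
      rw [H.init, H.init, Prod.norm_def]
      have := H.lip_g.norm_sub_le y y'
      have h1 : (0 : ℝ) ≤ N * ‖y - y'‖ := by positivity
      have h2 := norm_nonneg (y - y')
      exact max_le (by simp; linarith) (by simp; linarith)
    have hder : ∀ τ ∈ Icc 0 T, HasDerivWithinAt (fun τ => (Γ y τ).1 - (Γ y' τ).1)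
        (hp (Γ y τ) - hp (Γ y' τ)) (Icc 0 T) τ := fun τ _ =>
      (((H.char y).hasDerivAt_fst τ).sub ((H.char y').hasDerivAt_fst τ)).hasDerivWithinAt
    have hb : ∀ τ ∈ Icc 0 T, ‖hp (Γ y τ) - hp (Γ y' τ)‖ ≤
        (M + 1) * (Real.exp (M * T) * (1 + N)) * ‖y - y'‖ := by
      intro τ hτ
      have h1 := H.lip_p.norm_sub_le (Γ y τ) (Γ y' τ)
      have h2 := H.norm_sub_le_exp h0 hτ y y'
      calc ‖hp (Γ y τ) - hp (Γ y' τ)‖ ≤ M * (Real.exp (M * T) * ((1 + N) * ‖y - y'‖)) :=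
            h1.trans (by gcongr; exact h2.trans (by gcongr))
        _ ≤ (M + 1) * (Real.exp (M * T) * ((1 + N) * ‖y - y'‖)) := by gcongr; linarith
        _ = _ := by ring
    have := (convex_Icc (0 : ℝ) T).norm_image_sub_le_of_norm_hasDerivWithin_le hder hb hs hs'
    rw [Real.norm_eq_abs] at this
    calc _ = ‖(Γ y s').1 - (Γ y' s').1 - ((Γ y s).1 - (Γ y' s).1)‖ := by congr 1; abel
      _ ≤ _ := this
      _ = _ := by ring

theorem fst_footpoint [CompleteSpace V] (H : IsCharField h hx hp M G g N T K Γ S) {s : ℝ} (hs : s ∈ Icc 0 T) (x : V) :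
    (Γ (footpoint Γ s x) s).1 = x :=
  Function.invFun_eq (H.surjective (hs.1.trans hs.2) s hs x)

theorem footpoint_fst [CompleteSpace V] (H : IsCharField h hx hp M G g N T K Γ S) {s : ℝ} (hs : s ∈ Icc 0 T) (y : V) :
    footpoint Γ s (Γ y s).1 = y := by
  have h1 := H.norm_sub_le hs ⟨le_rfl, hs.1.trans hs.2⟩ (footpoint Γ s (Γ y s).1) y
  rw [H.fst_footpoint hs, sub_self, norm_zero, mul_zero, H.init, H.init] at h1
  exact congrArg Prod.fst (sub_eq_zero.1 (norm_le_zero_iff.1 h1))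

/-- Along the characteristics, the momentum is the gradient of the action up to second order. -/
theorem abs_action_sub_le (H : IsCharField h hx hp M G g N T K Γ S) {s : ℝ} (hs : s ∈ Icc 0 T)
    (y y' : V) :
    |S y' s - S y s - inner ℝ (Γ y s).2 ((Γ y' s).1 - (Γ y s).1)| ≤
      (N + 3 * M * T) * (Real.exp (M * T) * K) ^ 2 * ‖(Γ y' s).1 - (Γ y s).1‖ ^ 2 := by
  set A := Real.exp (M * T) * K with hA
  set D := ‖(Γ y' s).1 - (Γ y s).1‖ with hD
  have h0 : (0 : ℝ) ∈ Icc 0 T := ⟨le_rfl, hs.1.trans hs.2⟩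
  have hdist : ∀ τ ∈ Icc 0 T, ‖Γ y' τ - Γ y τ‖ ^ 2 ≤ (A * D) ^ 2 := fun τ hτ =>
    pow_le_pow_left₀ (norm_nonneg _) (H.norm_sub_le hs hτ y' y) 2
  -- In the derivative of e the first-order terms cancel by Hamilton's equations and the definition
  -- of the action. What remains is a product of two differences minus a Taylor remainder of h,
  -- hence the factor 3M = M + 2M.
  set e : ℝ → ℝ := fun s => S y' s - S y s - inner ℝ (Γ y s).2 ((Γ y' s).1 - (Γ y s).1) with he
  have he' : ∀ τ, HasDerivAt e ((inner ℝ (Γ y' τ).2 (hp (Γ y' τ)) - h (Γ y' τ)) -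
      (inner ℝ (Γ y τ).2 (hp (Γ y τ)) - h (Γ y τ)) -
      (inner ℝ (Γ y τ).2 (hp (Γ y' τ) - hp (Γ y τ)) +
        inner ℝ (-hx (Γ y τ)) ((Γ y' τ).1 - (Γ y τ).1))) τ := fun τ =>
    ((H.action_deriv y' τ).sub (H.action_deriv y τ)).sub
      (((H.char y).hasDerivAt_snd τ).inner ℝ
        (((H.char y').hasDerivAt_fst τ).sub ((H.char y).hasDerivAt_fst τ)))
  have hbound : ∀ τ ∈ Ico 0 s, ‖(inner ℝ (Γ y' τ).2 (hp (Γ y' τ)) - h (Γ y' τ)) -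
      (inner ℝ (Γ y τ).2 (hp (Γ y τ)) - h (Γ y τ)) -
      (inner ℝ (Γ y τ).2 (hp (Γ y' τ) - hp (Γ y τ)) +
        inner ℝ (-hx (Γ y τ)) ((Γ y' τ).1 - (Γ y τ).1))‖ ≤ 3 * M * (A * D) ^ 2 := by
    intro τ hτ
    have hτ' : τ ∈ Icc 0 T := ⟨hτ.1, hτ.2.le.trans hs.2⟩
    have h1 := H.remainder (Γ y τ) (Γ y' τ)
    have h2 : |inner ℝ ((Γ y' τ).2 - (Γ y τ).2) (hp (Γ y' τ) - hp (Γ y τ))| ≤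
        M * ‖Γ y' τ - Γ y τ‖ ^ 2 := by
      refine (abs_real_inner_le_norm _ _).trans ?_
      have h3 := H.lip_p.norm_sub_le (Γ y' τ) (Γ y τ)
      have h4 : ‖(Γ y' τ).2 - (Γ y τ).2‖ ≤ ‖Γ y' τ - Γ y τ‖ := norm_snd_le (Γ y' τ - Γ y τ)
      calc _ ≤ ‖Γ y' τ - Γ y τ‖ * (M * ‖Γ y' τ - Γ y τ‖) := by gcongr
        _ = _ := by ring
    have h5 : 3 * M * ‖Γ y' τ - Γ y τ‖ ^ 2 ≤ 3 * M * (A * D) ^ 2 := by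
      gcongr 3 * M * ?_
      exact hdist τ hτ'
    refine le_trans ?_ h5
    rw [Real.norm_eq_abs]
    have h6 : (inner ℝ (Γ y' τ).2 (hp (Γ y' τ)) - h (Γ y' τ)) -
      (inner ℝ (Γ y τ).2 (hp (Γ y τ)) - h (Γ y τ)) -
      (inner ℝ (Γ y τ).2 (hp (Γ y' τ) - hp (Γ y τ)) +
        inner ℝ (-hx (Γ y τ)) ((Γ y' τ).1 - (Γ y τ).1)) =
      inner ℝ ((Γ y' τ).2 - (Γ y τ).2) (hp (Γ y' τ) - hp (Γ y τ)) -
      (h (Γ y' τ) - h (Γ y τ) - inner ℝ (hx (Γ y τ)) ((Γ y' τ).1 - (Γ y τ).1) -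
        inner ℝ (hp (Γ y τ)) ((Γ y' τ).2 - (Γ y τ).2)) := by
      simp only [inner_sub_left, inner_sub_right, inner_neg_left,
        real_inner_comm (Γ y' τ).2 (hp (Γ y τ)), real_inner_comm (Γ y τ).2 (hp (Γ y τ))]
      ring
    rw [h6]
    refine (abs_sub _ _).trans ?_
    linarith
  have hmv := norm_image_sub_le_of_norm_deriv_le_segment' (f := e)
    (fun τ _ => (he' τ).hasDerivWithinAt) hbound s ⟨hs.1, le_rfl⟩
  have he0 : |e 0| ≤ N * (A * D) ^ 2 := by
    have h1 := abs_sub_sub_le_of_lipschitz_deriv (f := G) (f' := fun y => innerSL ℝ (g y)) (C := N)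
      (z := y) (z' := y') (fun w _ => H.hasFDerivAt_init w) N.coe_nonneg (fun w _ => by
        rw [← map_sub, innerSL_apply_norm]; exact H.lip_g.norm_sub_le w y)
    have h2 : ‖y' - y‖ ^ 2 ≤ (A * D) ^ 2 := by
      refine le_trans (pow_le_pow_left₀ (norm_nonneg _) ?_ 2) (hdist 0 h0)
      rw [H.init, H.init]
      exact norm_fst_le ((y', g y') - (y, g y))
    simp only [he, H.action_init, H.init]
    exact h1.trans (by gcongr)
  rw [Real.norm_eq_abs, sub_zero] at hmv
  have h7 : |e s| ≤ |e s - e 0| + |e 0| := by simpa using abs_add_le (e s - e 0) (e 0)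
  have h8 : 3 * M * (A * D) ^ 2 * s ≤ 3 * M * (A * D) ^ 2 * T := by gcongr; exact hs.2
  calc |e s| ≤ 3 * M * (A * D) ^ 2 * T + N * (A * D) ^ 2 := by linarith
    _ = _ := by ring

/-- The derivative of the value function. -/
theorem hasFDerivWithinAt_value [CompleteSpace V] (H : IsCharField h hx hp M G g N T K Γ S) {s : ℝ}
    (hs : s ∈ Icc 0 T) (x : V) :
    HasFDerivWithinAt (Function.uncurry (value Γ S))
      ((-h (x, momentum Γ s x)) • ContinuousLinearMap.fst ℝ ℝ V +
        (innerSL ℝ (momentum Γ s x)).comp (ContinuousLinearMap.snd ℝ ℝ V))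
      (Icc 0 T ×ˢ univ) (s, x) := by
  set y := footpoint Γ s x with hy
  have hyx : (Γ y s).1 = x := H.fst_footpoint hs x
  have hΓ : Γ y s = (x, momentum Γ s x) := Prod.ext hyx rfl
  set p := momentum Γ s x with hpdef
  -- The model m extends the action affinely off the single characteristic through (s, x), with
  -- slope its momentum. It is differentiable without any regularity of the footpoint, and the value
  -- differs from it by at most C‖ρ‖², which is o of the increment.
  set ρ : ℝ × V → V := fun q => q.2 - (Γ y q.1).1 with hρ
  set m : ℝ × V → ℝ := fun q => S y q.1 + inner ℝ (Γ y q.1).2 (ρ q) with hm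
  have hcurve : ∀ {c : ℝ → V} {c' : V}, HasDerivAt c c' s → HasFDerivAt (fun q : ℝ × V => c q.1)
      ((ContinuousLinearMap.fst ℝ ℝ V).smulRight c') (s, x) := fun {c c'} hc => by
    have h1 : HasFDerivAt (Prod.fst : ℝ × V → ℝ) (ContinuousLinearMap.fst ℝ ℝ V) (s, x) :=
      hasFDerivAt_fst
    refine (HasFDerivAt.comp (s, x) (g := c) (hasDerivAt_iff_hasFDerivAt.1 hc) h1).congr_fderiv ?_
    ext <;> simp
  have hρ' : HasFDerivAt ρ (ContinuousLinearMap.snd ℝ ℝ V -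
      (ContinuousLinearMap.fst ℝ ℝ V).smulRight (hp (Γ y s))) (s, x) := by
    refine hasFDerivAt_snd.sub ?_
    exact hcurve ((H.char y).hasDerivAt_fst s)
  have hp' : HasFDerivAt (fun q : ℝ × V => (Γ y q.1).2)
      ((ContinuousLinearMap.fst ℝ ℝ V).smulRight (-hx (Γ y s))) (s, x) :=
    hcurve ((H.char y).hasDerivAt_snd s)
  have hS' : HasFDerivAt (fun q : ℝ × V => S y q.1)
      ((inner ℝ (Γ y s).2 (hp (Γ y s)) - h (Γ y s)) • ContinuousLinearMap.fst ℝ ℝ V) (s, x) :=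
    (H.action_deriv y s).comp_hasFDerivAt (s, x) hasFDerivAt_fst
  have hρ0 : ρ (s, x) = 0 := by simp [hρ, hyx]
  have hm' : HasFDerivAt m ((-h (x, p)) • ContinuousLinearMap.fst ℝ ℝ V +
      (innerSL ℝ p).comp (ContinuousLinearMap.snd ℝ ℝ V)) (s, x) := by
    refine (hS'.add (hp'.inner ℝ hρ')).congr_fderiv ?_
    ext q
    · simp only [hρ0, hΓ]
      simp
      ring
    · simp [hρ0, hΓ]
  have hm0 : m (s, x) = value Γ S s x := by
    simp only [hm, hρ0, inner_zero_right, add_zero]; rfl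
  set C := (N + 3 * M * T) * (Real.exp (M * T) * K) ^ 2 with hC
  have hquad : ∀ q ∈ Icc 0 T ×ˢ (univ : Set V),
      |Function.uncurry (value Γ S) q - m q| ≤ C * ‖ρ q‖ ^ 2 := by
    rintro ⟨s', x'⟩ ⟨hs', -⟩
    have h1 := H.abs_action_sub_le hs' y (footpoint Γ s' x')
    rw [H.fst_footpoint hs'] at h1
    rw [← sub_sub]
    exact h1
  have hr : HasFDerivWithinAt (fun q => Function.uncurry (value Γ S) q - m q)
      (0 : ℝ × V →L[ℝ] ℝ) (Icc 0 T ×ˢ univ) (s, x) := by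
    rw [hasFDerivWithinAt_iff_isLittleO]
    have hO : ρ =O[𝓝 (s, x)] fun q => q - (s, x) := by
      simpa [hρ0] using hρ'.isBigO_sub
    have ho : ρ =o[𝓝 (s, x)] fun _ => (1 : ℝ) := by
      rw [Asymptotics.isLittleO_one_iff]
      have := hρ'.continuousAt.tendsto
      rwa [hρ0] at this
    have h2 : (fun q => ‖ρ q‖ * ‖ρ q‖) =o[𝓝 (s, x)] fun q => ‖q - (s, x)‖ * (1 : ℝ) :=
      (hO.norm_left.norm_right).mul_isLittleO ho.norm_left
    simp only [mul_one] at h2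
    have h3 : (fun q => Function.uncurry (value Γ S) q - m q) =O[𝓝[Icc 0 T ×ˢ univ] (s, x)]
        fun q => ‖ρ q‖ * ‖ρ q‖ := by
      refine Asymptotics.IsBigO.of_bound C ?_
      filter_upwards [self_mem_nhdsWithin] with q hq
      rw [Real.norm_eq_abs, norm_mul, norm_norm, ← sq]
      exact hquad q hq
    have h4 := (h3.trans_isLittleO (h2.mono nhdsWithin_le_nhds)).of_norm_right
    refine h4.congr_left fun q => ?_
    simp only [hm0]
    simp
  have := hr.add hm'.hasFDerivWithinAt
  simpa only [Pi.add_def, sub_add_cancel, zero_add] using this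

/-- The momentum is locally Lipschitz. -/
theorem locallyLipschitzOn_momentum [CompleteSpace V] (H : IsCharField h hx hp M G g N T K Γ S) :
    LocallyLipschitzOn (Icc 0 T ×ˢ (univ : Set V)) (Function.uncurry (momentum Γ)) := by
  rintro ⟨s₀, x₀⟩ ⟨hs₀, -⟩
  have hK : 0 < K := zero_lt_one.trans_le H.one_le
  set F : V × V → V × V := fun z => (hp z, -hx z) with hF
  have hFc : Continuous F := H.lipschitz_field.continuous
  obtain ⟨C₀, hC₀⟩ := isCompact_Icc.exists_bound_of_continuousOn (s := Icc 0 T)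
    (f := fun τ => F (Γ 0 τ)) (hFc.comp (H.char 0).continuous).continuousOn
  obtain ⟨C₁, hC₁⟩ := isCompact_Icc.exists_bound_of_continuousOn (s := Icc 0 T)
    (f := fun τ => (Γ 0 τ).1) (continuous_fst.comp (H.char 0).continuous).continuousOn
  set A := Real.exp (M * T) * K with hA
  set B := C₀ + M * (A * (‖x₀‖ + 1 + C₁)) with hB
  -- All characteristics passing near x₀ have bounded speed on [0, T], by comparison with the one
  -- issued from 0.
  have hspeed : ∀ s ∈ Icc 0 T, ∀ x : V, ‖x‖ ≤ ‖x₀‖ + 1 → ∀ τ ∈ Icc 0 T,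
      ‖F (Γ (footpoint Γ s x) τ)‖ ≤ B := by
    intro s hs x hx' τ hτ
    have h1 := H.lipschitz_field.norm_sub_le (Γ (footpoint Γ s x) τ) (Γ 0 τ)
    have h2 := H.norm_sub_le hs hτ (footpoint Γ s x) 0
    rw [H.fst_footpoint hs] at h2
    have h3 : ‖x - (Γ 0 s).1‖ ≤ ‖x₀‖ + 1 + C₁ :=
      (_root_.norm_sub_le _ _).trans (add_le_add hx' (hC₁ s hs))
    have h4 : ‖F (Γ (footpoint Γ s x) τ) - F (Γ 0 τ)‖ ≤ M * (A * (‖x₀‖ + 1 + C₁)) :=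
      h1.trans (by gcongr; exact h2.trans (by gcongr))
    calc ‖F (Γ (footpoint Γ s x) τ)‖
        = ‖F (Γ 0 τ) + (F (Γ (footpoint Γ s x) τ) - F (Γ 0 τ))‖ := by congr 1; abel
      _ ≤ _ := norm_add_le _ _
      _ ≤ B := add_le_add (hC₀ τ hτ) h4
  have hB0 : 0 ≤ B := (norm_nonneg _).trans (hspeed s₀ hs₀ x₀ (by linarith) s₀ hs₀)
  refine ⟨Real.toNNReal (K + (K + 1) * B), (Icc 0 T ×ˢ univ) ∩ {q | ‖q.2‖ < ‖x₀‖ + 1}, ?_, ?_⟩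
  · refine inter_mem_nhdsWithin _ (IsOpen.mem_nhds ?_ (by simp))
    exact isOpen_lt (by fun_prop) continuous_const
  · refine LipschitzOnWith.of_dist_le_mul ?_
    rintro ⟨s', x'⟩ ⟨⟨hs', -⟩, -⟩ ⟨s, x⟩ ⟨⟨hs, -⟩, hxs⟩
    have hxs' : ‖x‖ ≤ ‖x₀‖ + 1 := le_of_lt hxs
    rw [Real.coe_toNNReal _ (by positivity), dist_eq_norm, dist_eq_norm]
    set y := footpoint Γ s x with hy
    have hyx : (Γ y s).1 = x := H.fst_footpoint hs x
    have hmv : ‖Γ y s' - Γ y s‖ ≤ B * |s' - s| := by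
      have := (convex_Icc (0 : ℝ) T).norm_image_sub_le_of_norm_hasDerivWithin_le (f := Γ y)
        (f' := fun τ => F (Γ y τ)) (fun τ _ => (H.char y τ).hasDerivWithinAt)
        (hspeed s hs x hxs') hs hs'
      rwa [Real.norm_eq_abs] at this
    -- The characteristic through (s, x) is followed to time s' and compared there with the one
    -- through (s', x'). The moves in space and time produce K + (K + 1)B.
    have h1 := H.est s' hs' (footpoint Γ s' x') y
    rw [H.fst_footpoint hs'] at h1
    have h2 : ‖x' - (Γ y s').1‖ ≤ ‖x' - x‖ + ‖Γ y s' - Γ y s‖ := by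
      have : x' - (Γ y s').1 = (x' - x) - (Γ y s' - Γ y s).1 := by
        rw [Prod.fst_sub, hyx]; abel
      rw [this]
      exact (_root_.norm_sub_le _ _).trans (add_le_add le_rfl (norm_fst_le _))
    have h3 : ‖momentum Γ s' x' - momentum Γ s x‖ ≤
        ‖momentum Γ s' x' - (Γ y s').2‖ + ‖Γ y s' - Γ y s‖ := by
      have : momentum Γ s' x' - momentum Γ s x =
          (momentum Γ s' x' - (Γ y s').2) + (Γ y s' - Γ y s).2 := by
        rw [Prod.snd_sub]
        change _ = momentum Γ s' x' - (Γ y s').2 + ((Γ y s').2 - momentum Γ s x)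
        abel
      rw [this]
      exact (norm_add_le _ _).trans (add_le_add le_rfl (norm_snd_le _))
    have h4 : |s' - s| ≤ ‖((s', x') : ℝ × V) - (s, x)‖ := norm_fst_le (((s', x') : ℝ × V) - (s, x))
    have h5 : ‖x' - x‖ ≤ ‖((s', x') : ℝ × V) - (s, x)‖ := norm_snd_le (((s', x') : ℝ × V) - (s, x))
    simp only [Function.uncurry_apply_pair]
    calc ‖momentum Γ s' x' - momentum Γ s x‖
        ≤ K * (‖x' - x‖ + ‖Γ y s' - Γ y s‖) + ‖Γ y s' - Γ y s‖ :=
          h3.trans (add_le_add (h1.trans (by gcongr)) le_rfl)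
      _ = K * ‖x' - x‖ + (K + 1) * ‖Γ y s' - Γ y s‖ := by ring
      _ ≤ K * ‖((s', x') : ℝ × V) - (s, x)‖ + (K + 1) * (B * ‖((s', x') : ℝ × V) - (s, x)‖) := by
          gcongr
          exact hmv.trans (by gcongr)
      _ = _ := by ring

end IsCharField

end Characteristics

/-! ### Uniqueness along characteristics -/

theorem locallyLipschitzOn_comp {α β γ : Type*} [PseudoEMetricSpace α] [PseudoEMetricSpace β]
    [PseudoEMetricSpace γ] {f : β → γ} {g : α → β} {s : Set α} {t : Set β}
    (hf : LocallyLipschitzOn t f) (hg : LocallyLipschitzOn s g) (hst : MapsTo g s t) :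
    LocallyLipschitzOn s (f ∘ g) := by
  intro x hx
  obtain ⟨K, U, hU, hfU⟩ := hf (hst hx)
  obtain ⟨K', W, hW, hgW⟩ := hg hx
  have hc : Tendsto g (𝓝[s] x) (𝓝[t] (g x)) :=
    (hg.continuousOn x hx).tendsto_nhdsWithin hst
  exact ⟨K * K', W ∩ g ⁻¹' U, inter_mem hW (hc hU),
    hfU.comp (hgW.mono inter_subset_left) fun y hy => hy.2⟩

theorem locallyLipschitzOn_prodMk {α β γ : Type*} [PseudoEMetricSpace α] [PseudoEMetricSpace β]
    [PseudoEMetricSpace γ] {f : α → β} {g : α → γ} {s : Set α}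
    (hf : LocallyLipschitzOn s f) (hg : LocallyLipschitzOn s g) :
    LocallyLipschitzOn s fun x => (f x, g x) := by
  intro x hx
  obtain ⟨K, U, hU, hfU⟩ := hf hx
  obtain ⟨K', W, hW, hgW⟩ := hg hx
  exact ⟨max K K', U ∩ W, inter_mem hU hW,
    (hfU.mono inter_subset_left).prodMk (hgW.mono inter_subset_right)⟩

section Uniqueness

variable {V : Type*} [NormedAddCommGroup V] [InnerProductSpace ℝ V]

/-- A vector whose products with small vectors are bounded by `b` to first order has norm at
most `b`. -/
theorem norm_le_of_inner_le {w : V} {a b : ℝ} (hb : 0 ≤ b)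
    (hw : ∀ ξ : V, ‖ξ‖ ≤ 1 → inner ℝ w ξ ≤ a * ‖ξ‖ ^ 2 + b * ‖ξ‖) : ‖w‖ ≤ b := by
  by_cases h0 : w = 0
  · simpa [h0] using hb
  have hpos : 0 < ‖w‖ := norm_pos_iff.2 h0
  have hlim : Tendsto (fun ε : ℝ => a * ε + b) (𝓝[>] 0) (𝓝 b) := by
    have : Continuous fun ε : ℝ => a * ε + b := by fun_prop
    simpa using (this.tendsto 0).mono_left nhdsWithin_le_nhds
  refine ge_of_tendsto hlim ?_
  filter_upwards [Ioc_mem_nhdsGT (zero_lt_one' ℝ)] with ε hε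
  have hn : ‖(ε / ‖w‖) • w‖ = ε := by
    rw [norm_smul, Real.norm_of_nonneg (by have := hε.1; positivity)]
    field_simp
  have h1 := hw ((ε / ‖w‖) • w) (hn.le.trans hε.2)
  rw [hn, inner_smul_right, real_inner_self_eq_norm_sq] at h1
  have h2 : ε / ‖w‖ * ‖w‖ ^ 2 = ε * ‖w‖ := by field_simp
  rw [h2] at h1
  have h3 : ε * ‖w‖ ≤ ε * (a * ε + b) := by linarith [h1, sq ε]
  exact le_of_mul_le_mul_left h3 hε.1

/-- `v` solves `-∂ₜ v + h(x, ∂ₓ v) = 0`, its spatial gradient `Q` being locally Lipschitz up to the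
boundary. -/
structure IsLipSolution (h : V × V → ℝ) (T : ℝ) (v : ℝ × V → ℝ) (Q : ℝ × V → V) : Prop where
  continuousOn : ContinuousOn v (Icc 0 T ×ˢ univ)
  slice : ∀ t ∈ Icc 0 T, ∀ x, HasFDerivAt (fun x => v (t, x)) (innerSL ℝ (Q (t, x))) x
  deriv : ∀ t ∈ Ioo 0 T, ∀ x, HasFDerivAt v (h (x, Q (t, x)) • ContinuousLinearMap.fst ℝ ℝ V +
    (innerSL ℝ (Q (t, x))).comp (ContinuousLinearMap.snd ℝ ℝ V)) (t, x)
  lip : LocallyLipschitzOn (Icc 0 T ×ˢ univ) Q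

namespace IsLipSolution

variable {h : V × V → ℝ} {hx hp : V × V → V} {M : ℝ≥0} {T : ℝ} {v : ℝ × V → ℝ} {Q : ℝ × V → V}

theorem hasDerivAt_curve (hv : IsLipSolution h T v Q) {c : ℝ → V} {c' : V} {t : ℝ}
    (ht : t ∈ Ioo 0 T) (hc : HasDerivAt c c' t) :
    HasDerivAt (fun τ => v (τ, c τ)) (h (c t, Q (t, c t)) + inner ℝ (Q (t, c t)) c') t := by
  have := (hv.deriv t ht (c t)).comp_hasDerivAt t ((hasDerivAt_id t).prodMk hc)
  simpa [Function.comp_def] using this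

/-- A bound for the variation of the defect `Q - p` along a characteristic. -/
theorem norm_defect_sub_le (hv : IsLipSolution h T v Q) (hh : IsLipHamiltonian h hx hp M)
    {X P : ℝ → V} (hX : ∀ t, HasDerivAt X (-hp (X t, P t)) t)
    (hP : ∀ t, HasDerivAt P (hx (X t, P t)) t) {t₀ : ℝ} (ht₀ : 0 < t₀) {K : ℝ} (hK : 0 ≤ K)
    (hlip : ∀ t ∈ Icc t₀ T, ∀ ξ : V, ‖ξ‖ ≤ 1 → ‖Q (t, X t + ξ) - Q (t, X t)‖ ≤ K * ‖ξ‖)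
    {t t' η : ℝ} (ht : t₀ ≤ t) (htt' : t ≤ t') (ht' : t' ≤ T)
    (hη : ∀ τ ∈ Icc t t', ‖Q (τ, X τ) - P τ‖ ≤ η) :
    ‖(Q (t', X t') - P t') - (Q (t, X t) - P t)‖ ≤ M * (K + 1) * η * (t' - t) := by
  have hη0 : 0 ≤ η := (norm_nonneg _).trans (hη t ⟨le_rfl, htt'⟩)
  have hsub : ∀ τ ∈ Icc t t', τ ∈ Icc t₀ T := fun τ hτ => ⟨ht.trans hτ.1, hτ.2.trans ht'⟩
  -- Second-order errors in ξ: K at each endpoint from replacing an increment of v by its gradient,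
  -- and 2M(1 + K)² per unit time from the Taylor remainder of h. They disappear as ξ → 0.
  refine norm_le_of_inner_le (a := 2 * K + 2 * M * (1 + K) ^ 2 * (t' - t))
    (by have := sub_nonneg.2 htt'; positivity) fun ξ hξ => ?_
  have hrem : ∀ τ ∈ Icc t t',
      |v (τ, X τ + ξ) - v (τ, X τ) - inner ℝ (Q (τ, X τ)) ξ| ≤ K * ‖ξ‖ ^ 2 := by
    intro τ hτ
    have hτ' := hsub τ hτ
    have := abs_sub_sub_le_of_lipschitz_deriv (f := fun x => v (τ, x))
      (f' := fun x => innerSL ℝ (Q (τ, x))) (z := X τ) (z' := X τ + ξ) (C := K)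
      (fun w _ => hv.slice τ ⟨ht₀.le.trans hτ'.1, hτ'.2⟩ w) hK (fun w hw => by
        obtain ⟨θ, hθ, rfl⟩ := (segment_eq_image' ℝ (X τ) (X τ + ξ)) ▸ hw
        rw [← map_sub, innerSL_apply_norm]
        simp only [add_sub_cancel_left]
        refine hlip τ hτ' _ ?_
        rw [norm_smul, Real.norm_of_nonneg hθ.1]
        exact (mul_le_of_le_one_left (norm_nonneg _) hθ.2).trans hξ)
    simpa using this
  set f : ℝ → ℝ := fun τ => v (τ, X τ + ξ) - v (τ, X τ) - inner ℝ (P τ) ξ with hf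
  have hXc : Continuous X := continuous_iff_continuousAt.2 fun τ => (hX τ).continuousAt
  have hPc : Continuous P := continuous_iff_continuousAt.2 fun τ => (hP τ).continuousAt
  have hmaps : ∀ c : ℝ → V, MapsTo (fun τ => (τ, c τ)) (Icc t t') (Icc 0 T ×ˢ (univ : Set V)) :=
    fun c τ hτ => ⟨⟨ht₀.le.trans (hsub τ hτ).1, (hsub τ hτ).2⟩, trivial⟩
  have hfc : ContinuousOn f (Icc t t') := by
    refine ((hv.continuousOn.comp ?_ (hmaps fun τ => X τ + ξ)).sub
      (hv.continuousOn.comp ?_ (hmaps X))).sub ?_ <;> exact Continuous.continuousOn (by fun_prop)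
  have hf' : ∀ τ ∈ Ico t t', HasDerivWithinAt f
      ((h (X τ + ξ, Q (τ, X τ + ξ)) + inner ℝ (Q (τ, X τ + ξ)) (-hp (X τ, P τ))) -
        (h (X τ, Q (τ, X τ)) + inner ℝ (Q (τ, X τ)) (-hp (X τ, P τ))) -
        inner ℝ (hx (X τ, P τ)) ξ) (Ici τ) τ := by
    intro τ hτ
    have hτ' : τ ∈ Ioo 0 T := ⟨ht₀.trans_le (ht.trans hτ.1), hτ.2.trans_le ht'⟩
    have h1 := hv.hasDerivAt_curve hτ' ((hX τ).add_const ξ)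
    have h2 := hv.hasDerivAt_curve hτ' (hX τ)
    have h3 : HasDerivAt (fun τ => inner ℝ (P τ) ξ) (inner ℝ (hx (X τ, P τ)) ξ) τ := by
      simpa using (hP τ).inner ℝ (hasDerivAt_const τ ξ)
    exact ((h1.sub h2).sub h3).hasDerivWithinAt
  have hbound : ∀ τ ∈ Ico t t', ‖(h (X τ + ξ, Q (τ, X τ + ξ)) +
      inner ℝ (Q (τ, X τ + ξ)) (-hp (X τ, P τ))) -
        (h (X τ, Q (τ, X τ)) + inner ℝ (Q (τ, X τ)) (-hp (X τ, P τ))) -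
        inner ℝ (hx (X τ, P τ)) ξ‖ ≤ 2 * M * (1 + K) ^ 2 * ‖ξ‖ ^ 2 + M * (K + 1) * η * ‖ξ‖ := by
    intro τ hτ
    have hτ' : τ ∈ Icc t t' := Ico_subset_Icc_self hτ
    set q := Q (τ, X τ)
    set qξ := Q (τ, X τ + ξ)
    have hq : ‖qξ - q‖ ≤ K * ‖ξ‖ := hlip τ (hsub τ hτ') ξ hξ
    have h1 := hh.remainder (X τ, q) (X τ + ξ, qξ)
    have h2 : ‖((X τ + ξ, qξ) : V × V) - (X τ, q)‖ ≤ (1 + K) * ‖ξ‖ := by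
      rw [Prod.norm_def]
      have h3 := norm_nonneg ξ
      have h4 : 0 ≤ K * ‖ξ‖ := by positivity
      exact max_le (by simp; linarith) (by simp; linarith)
    have h5 : ‖((X τ, q) : V × V) - (X τ, P τ)‖ ≤ η := by
      rw [Prod.norm_def]
      exact max_le (by simpa using hη0) (by simpa using hη τ hτ')
    have h6 : |inner ℝ (hp (X τ, q) - hp (X τ, P τ)) (qξ - q)| ≤ M * η * (K * ‖ξ‖) := by
      refine (abs_real_inner_le_norm _ _).trans ?_
      gcongr
      exact (hh.lip_p.norm_sub_le _ _).trans (by gcongr)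
    have h7 : |inner ℝ (hx (X τ, q) - hx (X τ, P τ)) ξ| ≤ M * η * ‖ξ‖ := by
      refine (abs_real_inner_le_norm _ _).trans ?_
      gcongr
      exact (hh.lip_x.norm_sub_le _ _).trans (by gcongr)
    have h8 : 2 * M * ‖((X τ + ξ, qξ) : V × V) - (X τ, q)‖ ^ 2 ≤
        2 * M * ((1 + K) * ‖ξ‖) ^ 2 := by gcongr
    -- Both v(τ, X + ξ) and v(τ, X) are followed at the same velocity. Expanding h at (X, q) leaves
    -- only gradient differences of h between q and P, which are linear in the defect.
    have h9 : (h (X τ + ξ, qξ) + inner ℝ qξ (-hp (X τ, P τ))) -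
        (h (X τ, q) + inner ℝ q (-hp (X τ, P τ))) - inner ℝ (hx (X τ, P τ)) ξ =
        (h (X τ + ξ, qξ) - h (X τ, q) - inner ℝ (hx (X τ, q)) (X τ + ξ - X τ) -
          inner ℝ (hp (X τ, q)) (qξ - q)) +
        inner ℝ (hp (X τ, q) - hp (X τ, P τ)) (qξ - q) +
        inner ℝ (hx (X τ, q) - hx (X τ, P τ)) ξ := by
      simp only [inner_sub_left, inner_sub_right, inner_neg_right, add_sub_cancel_left,
        real_inner_comm (hp (X τ, P τ)) qξ, real_inner_comm (hp (X τ, P τ)) q]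
      ring
    rw [h9, Real.norm_eq_abs]
    refine (abs_add_three _ _ _).trans ?_
    have h10 : 2 * M * ((1 + K) * ‖ξ‖) ^ 2 + M * η * (K * ‖ξ‖) + M * η * ‖ξ‖ =
        2 * M * (1 + K) ^ 2 * ‖ξ‖ ^ 2 + M * (K + 1) * η * ‖ξ‖ := by ring
    simp only at h1
    linarith
  have hmv := norm_image_sub_le_of_norm_deriv_right_le_segment hfc hf' hbound t' ⟨htt', le_rfl⟩
  rw [Real.norm_eq_abs] at hmv
  have e1 := abs_le.1 (hrem t ⟨le_rfl, htt'⟩)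
  have e2 := abs_le.1 (hrem t' ⟨htt', le_rfl⟩)
  have e3 := (abs_le.1 hmv).2
  simp only [hf] at e3
  simp only [inner_sub_left]
  linarith [e1.1, e1.2, e2.1, e2.2]

/-- A solution with locally Lipschitz gradient has its gradient transported by characteristics. -/
theorem gradient_eq_of_characteristic [ProperSpace V] (hv : IsLipSolution h T v Q)
    (hh : IsLipHamiltonian h hx hp M)
    {X P : ℝ → V} (hX : ∀ t, HasDerivAt X (-hp (X t, P t)) t)
    (hP : ∀ t, HasDerivAt P (hx (X t, P t)) t) {t₀ : ℝ} (ht₀ : 0 < t₀)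
    (h0 : Q (t₀, X t₀) = P t₀) : ∀ t ∈ Icc t₀ T, Q (t, X t) = P t := by
  have hXc : Continuous X := continuous_iff_continuousAt.2 fun τ => (hX τ).continuousAt
  have hPc : Continuous P := continuous_iff_continuousAt.2 fun τ => (hP τ).continuousAt
  -- A compact tube around the curve X, on which Q has a single Lipschitz constant.
  set A : Set (ℝ × V) :=
    (fun q : ℝ × V => (q.1, X q.1 + q.2)) '' (Icc t₀ T ×ˢ Metric.closedBall 0 1) with hA
  have hAc : IsCompact A := (isCompact_Icc.prod (isCompact_closedBall 0 1)).image (by fun_prop)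
  have hAs : A ⊆ Icc 0 T ×ˢ univ := by
    rintro _ ⟨q, hq, rfl⟩
    exact ⟨⟨ht₀.le.trans hq.1.1, hq.1.2⟩, trivial⟩
  obtain ⟨K, hK⟩ := (hv.lip.mono hAs).exists_lipschitzOnWith_of_compact hAc
  have hlip : ∀ t ∈ Icc t₀ T, ∀ ξ : V, ‖ξ‖ ≤ 1 →
      ‖Q (t, X t + ξ) - Q (t, X t)‖ ≤ K * ‖ξ‖ := by
    intro t ht ξ hξ
    have h1 : (t, X t + ξ) ∈ A := ⟨(t, ξ), ⟨ht, by simpa using hξ⟩, rfl⟩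
    have h2 : (t, X t) ∈ A := ⟨(t, 0), ⟨ht, by simp⟩, by simp⟩
    have := hK.norm_sub_le h1 h2
    simpa [Prod.norm_def] using this
  set δ : ℝ → V := fun t => Q (t, X t) - P t with hδ
  have hδc : ContinuousOn δ (Icc t₀ T) := by
    refine (hv.lip.continuousOn.comp (Continuous.continuousOn (by fun_prop)) ?_).sub
      hPc.continuousOn
    exact fun τ hτ => ⟨⟨ht₀.le.trans hτ.1, hτ.2⟩, trivial⟩
  set C : ℝ := M * (K + 1) with hC
  have hC0 : 0 ≤ C := by positivity
  have hgr := le_gronwallBound_of_liminf_deriv_right_le (f := fun t => ‖δ t‖)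
    (f' := fun t => C * ‖δ t‖) (δ := 0) (K := C) (ε := 0) (a := t₀) (b := T) hδc.norm ?_
    (by simp [hδ, h0]) (fun t _ => by simp)
  · intro t ht
    have := hgr t ht
    rw [gronwallBound_ε0_δ0] at this
    exact sub_eq_zero.1 (norm_le_zero_iff.1 this)
  · intro t ht r hr
    -- A bound slightly above ‖δ t‖, so that C * η < r still holds; by continuity it bounds δ just
    -- after t. This controls the right Dini derivative of ‖δ‖, which need not be differentiable.
    set η := ‖δ t‖ + (r - C * ‖δ t‖) / (2 * (C + 1)) with hη
    have hgap : 0 < (r - C * ‖δ t‖) / (2 * (C + 1)) := div_pos (by linarith) (by linarith)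
    have hCη : C * η < r := by
      have h1 : C * ((r - C * ‖δ t‖) / (2 * (C + 1))) ≤ (r - C * ‖δ t‖) / 2 := by
        rw [mul_div_assoc', div_le_div_iff₀ (by linarith) (by norm_num)]
        nlinarith
      rw [hη, mul_add]
      linarith
    have hcont := (hδc t (Ico_subset_Icc_self ht)).norm
    have hev : ∀ᶠ τ in 𝓝[Icc t₀ T] t, ‖δ τ‖ < η := hcont.eventually (gt_mem_nhds (by linarith))
    obtain ⟨d, hd, hdη⟩ := Metric.mem_nhdsWithin_iff.1 hev
    have hmem : Ioo t (min (t + d) T) ∈ 𝓝[>] t :=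
      Ioo_mem_nhdsGT (lt_min (by linarith) ht.2)
    refine Eventually.frequently ?_
    filter_upwards [hmem] with z hz
    have hzd : z < t + d := hz.2.trans_le (min_le_left _ _)
    have hzT : z ≤ T := (hz.2.trans_le (min_le_right _ _)).le
    have hb := hv.norm_defect_sub_le hh hX hP ht₀ K.coe_nonneg hlip ht.1 hz.1.le hzT (η := η)
      (fun τ hτ => le_of_lt (hdη ⟨by
        rw [Metric.mem_ball, Real.dist_eq, abs_of_nonneg (by linarith [hτ.1])]
        linarith [hτ.2], ⟨ht.1.trans hτ.1, hτ.2.trans hzT⟩⟩))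
    have hzt : 0 < z - t := sub_pos.2 hz.1
    rw [inv_mul_lt_iff₀ hzt]
    calc ‖δ z‖ - ‖δ t‖ ≤ ‖δ z - δ t‖ := norm_sub_norm_le _ _
      _ ≤ C * η * (z - t) := hb
      _ < r * (z - t) := by gcongr
      _ = (z - t) * r := mul_comm _ _

end IsLipSolution

/-- Solutions with locally Lipschitz gradient agree with the value function. -/
theorem IsCharField.eq_value [ProperSpace V] [CompleteSpace V] {h : V × V → ℝ} {hx hp : V × V → V}
    {M : ℝ≥0} {G : V → ℝ} {g : V → V} {N : ℝ≥0} {T K : ℝ} {Γ : V → ℝ → V × V} {S : V → ℝ → ℝ}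
    (H : IsCharField h hx hp M G g N T K Γ S)
    (hex : ∀ z, ∃ γ, γ 0 = z ∧ IsCharacteristic hx hp γ)
    {v : ℝ × V → ℝ} {Q : ℝ × V → V} (hv : IsLipSolution h T v Q) (hvG : ∀ x, v (T, x) = G x)
    {t₀ : ℝ} (ht₀ : t₀ ∈ Ioo 0 T) (x₀ : V) : v (t₀, x₀) = value Γ S (T - t₀) x₀ := by
  obtain ⟨γ, hγ0, hγ⟩ := hex (x₀, Q (t₀, x₀))
  set X : ℝ → V := fun t => (γ (t₀ - t)).1 with hXdef
  set P : ℝ → V := fun t => (γ (t₀ - t)).2 with hPdef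
  have hX : ∀ t, HasDerivAt X (-hp (X t, P t)) t := fun t => by
    simpa [Function.comp_def] using (hγ.hasDerivAt_fst (t₀ - t)).scomp t
      ((hasDerivAt_id t).const_sub t₀)
  have hP : ∀ t, HasDerivAt P (hx (X t, P t)) t := fun t => by
    simpa [Function.comp_def] using (hγ.hasDerivAt_snd (t₀ - t)).scomp t
      ((hasDerivAt_id t).const_sub t₀)
  have hX0 : X t₀ = x₀ := by simp [hXdef, hγ0]
  have hP0 : P t₀ = Q (t₀, x₀) := by simp [hPdef, hγ0]
  have hQP := hv.gradient_eq_of_characteristic H.toIsLipHamiltonian hX hP ht₀.1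
    (by rw [hX0, hP0])
  have hTm : T ∈ Icc t₀ T := ⟨ht₀.2.le, le_rfl⟩
  have hT0 : T ∈ Icc 0 T := ⟨(ht₀.1.trans ht₀.2).le, le_rfl⟩
  set y := X T with hy
  -- At time T the transported momentum is the gradient of v(T, ·) = G, so the curve, run backwards
  -- from T, has the initial data of Γ y.
  have hPT : P T = g y := by
    rw [← hQP T hTm]
    have h1 := hv.slice T hT0 y
    simp only [hvG] at h1
    have h2 := h1.unique (H.hasFDerivAt_init y)
    have h3 : innerSL ℝ (Q (T, y) - g y) = 0 := by rw [map_sub, h2, sub_self]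
    have h4 := innerSL_apply_norm (𝕜 := ℝ) (Q (T, y) - g y)
    rw [h3, norm_zero] at h4
    exact sub_eq_zero.1 (norm_eq_zero.1 h4.symm)
  have hshift : IsCharacteristic hx hp fun s => γ (t₀ - T + s) := fun s => by
    simpa [Function.comp_def] using (hγ (t₀ - T + s)).scomp s ((hasDerivAt_id s).const_add (t₀ - T))
  have hΓγ : ∀ s, Γ y s = γ (t₀ - T + s) := fun s => by
    have h1 := norm_integralCurve_sub_le H.lipschitz_field (H.char y) hshift 0 s
    have h2 : γ (t₀ - T + 0) = (y, g y) := by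
      rw [add_zero]; exact Prod.ext rfl hPT
    rw [h2, H.init, sub_self, norm_zero, zero_mul] at h1
    exact sub_eq_zero.1 (norm_le_zero_iff.1 h1)
  have hΓXP : ∀ t, Γ y (T - t) = (X t, P t) := fun t => by
    rw [hΓγ]; simp [hXdef, hPdef]
  have hXc : Continuous X := continuous_iff_continuousAt.2 fun τ => (hX τ).continuousAt
  have hconst := constant_of_has_deriv_right_zero (f := fun t => v (t, X t) - S y (T - t))
    (a := t₀) (b := T) ?_ ?_ T hTm
  · have h1 : v (T, X T) - S y (T - T) = 0 := by
      rw [sub_self, H.action_init, hvG]; exact sub_self _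
    rw [h1, hX0] at hconst
    have h2 := H.footpoint_fst (s := T - t₀) ⟨by linarith [ht₀.2], by linarith [ht₀.1]⟩ y
    rw [hΓXP, hX0] at h2
    rw [value, h2]
    linarith
  · refine (hv.continuousOn.comp (Continuous.continuousOn (by fun_prop)) ?_).sub ?_
    · exact fun τ hτ => ⟨⟨ht₀.1.le.trans hτ.1, hτ.2⟩, trivial⟩
    · have hS : Continuous (S y) :=
        continuous_iff_continuousAt.2 fun τ => (H.action_deriv y τ).continuousAt
      exact Continuous.continuousOn (by fun_prop)
  · intro t ht
    have h1 := hv.hasDerivAt_curve ⟨ht₀.1.trans_le ht.1, ht.2⟩ (hX t)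
    have h2 := (H.action_deriv y (T - t)).scomp t ((hasDerivAt_id t).const_sub T)
    rw [hΓXP] at h2
    rw [hQP t (Ico_subset_Icc_self ht)] at h1
    have h3 := (h1.sub h2).hasDerivWithinAt (s := Ici t)
    refine h3.congr_deriv ?_
    simp

end Uniqueness

/-! ### Well-posedness from the characteristic field -/

theorem uniqueDiffOn_strip (d : ℕ) {T : ℝ} (hT : 0 < T) : UniqueDiffOn ℝ (strip d T) :=
  (uniqueDiffOn_Icc hT).prod uniqueDiffOn_univ

theorem strip_mem_nhds {d : ℕ} {T t : ℝ} (ht : t ∈ Ioo 0 T) (x : E d) : strip d T ∈ 𝓝 (t, x) :=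
  prod_mem_nhds (Icc_mem_nhds ht.1 ht.2) univ_mem

variable {d : ℕ}

/-- Solutions of class `C^{1,1}_loc` have a locally Lipschitz spatial gradient. -/
theorem exists_isLipSolution {H : E d → E d → ℝ} {G : E d → ℝ} {T : ℝ}
    {v : ℝ → E d → ℝ} (hv : IsC11loc T v) (hs : SolvesHJB H G T v) :
    ∃ Q, IsLipSolution (Function.uncurry H) T (Function.uncurry v) Q := by
  set D := fderivWithin ℝ (Function.uncurry v) (strip d T) with hD
  set ψ : (ℝ × E d →L[ℝ] ℝ) → E d := fun A =>
    (InnerProductSpace.toDual ℝ (E d)).symm (A.comp (ContinuousLinearMap.inr ℝ ℝ (E d))) with hψ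
  have hin : ∀ A, innerSL ℝ (ψ A) = A.comp (ContinuousLinearMap.inr ℝ ℝ (E d)) := fun A => by
    ext x
    simp [hψ]
  have hψl : LipschitzWith 1 ψ := by
    refine LipschitzWith.of_dist_le_mul fun A B => ?_
    rw [hψ, LinearIsometryEquiv.dist_map, dist_eq_norm, dist_eq_norm,
      ← ContinuousLinearMap.sub_comp]
    refine (ContinuousLinearMap.opNorm_comp_le _ _).trans ?_
    rw [NNReal.coe_one, one_mul]
    exact mul_le_of_le_one_right (norm_nonneg _) (ContinuousLinearMap.norm_inr_le_one ℝ ℝ (E d))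
  have hder : ∀ q ∈ strip d T, HasFDerivWithinAt (Function.uncurry v) (D q) (strip d T) q :=
    fun q hq => (hv.1.differentiableOn (by norm_num) q hq).hasFDerivWithinAt
  have hslice : ∀ t ∈ Icc 0 T, ∀ x, HasFDerivAt (v t) (innerSL ℝ (ψ (D (t, x)))) x := by
    intro t ht x
    rw [hin]
    have h1 : HasFDerivWithinAt (fun y : E d => (t, y)) (ContinuousLinearMap.inr ℝ ℝ (E d)) univ x :=
      (hasFDerivAt_prodMk_right t x).hasFDerivWithinAt
    have h2 := (hder (t, x) ⟨ht, trivial⟩).comp x h1 fun y _ => ⟨ht, trivial⟩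
    exact h2.hasFDerivAt univ_mem
  refine ⟨fun q => ψ (D q), hv.1.continuousOn, fun t ht x => hslice t ht x, ?_, ?_⟩
  · intro t ht x
    have h1 : HasFDerivAt (Function.uncurry v) (D (t, x)) (t, x) :=
      (hder (t, x) ⟨Ioo_subset_Icc_self ht, trivial⟩).hasFDerivAt (strip_mem_nhds ht x)
    have h2 : HasDerivAt (fun s => v s x) (D (t, x) (1, 0)) t := by
      have := h1.comp_hasDerivAt t ((hasDerivAt_id t).prodMk (hasDerivAt_const t x))
      exact this
    have h3 : gradient (v t) x = ψ (D (t, x)) := by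
      have h4 : HasGradientAt (v t) (ψ (D (t, x))) x := by
        rw [hasGradientAt_iff_hasFDerivAt]
        exact hslice t (Ioo_subset_Icc_self ht) x
      exact h4.gradient
    have h5 := hs.1 t ht x
    rw [h2.deriv, h3] at h5
    refine h1.congr_fderiv ?_
    rw [hin]
    ext
    · have h6 : D (t, x) ((0 : ℝ), (0 : E d)) = 0 := map_zero (D (t, x))
      simp only [Function.uncurry_apply_pair]
      simp
      linarith
    · simp
  · exact locallyLipschitzOn_comp (t := univ) (f := ψ) (g := D) hψl.locallyLipschitz.locallyLipschitzOn hv.2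
      fun _ _ => trivial

/-- Existence and uniqueness on a horizon on which the characteristic field is not degenerate. -/
theorem IsCharField.wellPosed {H : E d → E d → ℝ} {hx hp : E d × E d → E d}
    {M : ℝ≥0} {G : E d → ℝ} {g : E d → E d} {N : ℝ≥0} {T K : ℝ} {Γ : E d → ℝ → E d × E d}
    {S : E d → ℝ → ℝ} (hF : IsCharField (Function.uncurry H) hx hp M G g N T K Γ S)
    (hex : ∀ z, ∃ γ, γ 0 = z ∧ IsCharacteristic hx hp γ)
    (hH : ContDiff ℝ 1 (Function.uncurry H)) (hT : 0 < T) :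
    ∃ u : ℝ → E d → ℝ, (IsC11loc T u ∧ SolvesHJB H G T u) ∧
      ∀ v : ℝ → E d → ℝ, IsC11loc T v → SolvesHJB H G T v →
        ∀ t ∈ Set.Icc 0 T, ∀ x, v t x = u t x := by
  set u : ℝ → E d → ℝ := fun t x => value Γ S (T - t) x with hu
  set p : ℝ × E d → E d := fun q => momentum Γ (T - q.1) q.2 with hpdef
  set Φ : E d × E d → (ℝ × E d →L[ℝ] ℝ) := fun z =>
    Function.uncurry H z • ContinuousLinearMap.fst ℝ ℝ (E d) +
      (innerSL ℝ z.2).comp (ContinuousLinearMap.snd ℝ ℝ (E d)) with hΦ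
  have hrefl : ∀ t ∈ Icc 0 T, T - t ∈ Icc 0 T := fun t ht =>
    ⟨by linarith [ht.2], by linarith [ht.1]⟩
  have hmaps : MapsTo (fun q : ℝ × E d => (T - q.1, q.2)) (strip d T) (strip d T) :=
    fun q hq => ⟨hrefl _ hq.1, trivial⟩
  have hder : ∀ q ∈ strip d T,
      HasFDerivWithinAt (Function.uncurry u) (Φ (q.2, p q)) (strip d T) q := by
    rintro ⟨t, x⟩ ⟨ht, -⟩
    have h1 : HasFDerivWithinAt (fun q : ℝ × E d => (T - q.1, q.2))
        ((-ContinuousLinearMap.fst ℝ ℝ (E d)).prod (ContinuousLinearMap.snd ℝ ℝ (E d)))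
        (strip d T) (t, x) :=
      ((hasFDerivAt_fst.const_sub T).prodMk hasFDerivAt_snd).hasFDerivWithinAt
    have h2 := (hF.hasFDerivWithinAt_value (hrefl t ht) x).comp (t, x) h1 hmaps
    refine (h2.congr_fderiv ?_)
    ext <;> simp [hΦ, hpdef]
  have hfd : ∀ q ∈ strip d T,
      fderivWithin ℝ (Function.uncurry u) (strip d T) q = Φ (q.2, p q) := fun q hq =>
    (hder q hq).fderivWithin (uniqueDiffOn_strip d hT q hq)
  have hplip : LocallyLipschitzOn (strip d T) p := by
    have h1 : ContDiff ℝ 1 fun q : ℝ × E d => (T - q.1, q.2) := by fun_prop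
    exact locallyLipschitzOn_comp (f := Function.uncurry (momentum Γ))
      (g := fun q : ℝ × E d => (T - q.1, q.2)) hF.locallyLipschitzOn_momentum
      h1.locallyLipschitz.locallyLipschitzOn hmaps
  have hΦlip : LocallyLipschitzOn (strip d T) fun q => Φ (q.2, p q) := by
    have h1 : ContDiff ℝ 1 Φ := by
      refine (hH.smul contDiff_const).add ?_
      exact ((innerSL ℝ (E := E d)).contDiff.comp contDiff_snd).clm_comp contDiff_const
    have h2 : LocallyLipschitzOn (strip d T) (Prod.snd : ℝ × E d → E d) :=
      LipschitzWith.prod_snd.locallyLipschitz.locallyLipschitzOn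
    exact locallyLipschitzOn_comp (t := univ) (g := fun q : ℝ × E d => (q.2, p q))
      h1.locallyLipschitz.locallyLipschitzOn
      (locallyLipschitzOn_prodMk h2 hplip) fun _ _ => trivial
  have hlip : LocallyLipschitzOn (strip d T)
      (fderivWithin ℝ (Function.uncurry u) (strip d T)) := by
    intro q hq
    obtain ⟨C, U, hU, hC⟩ := hΦlip hq
    refine ⟨C, U ∩ strip d T, inter_mem hU self_mem_nhdsWithin, fun a ha b hb => ?_⟩
    rw [hfd a ha.2, hfd b hb.2]
    exact hC ha.1 hb.1
  have hC11 : IsC11loc T u := by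
    refine ⟨?_, hlip⟩
    have := contDiffOn_succ_iff_fderivWithin (n := 0) (f := Function.uncurry u)
      (uniqueDiffOn_strip d hT)
    rw [zero_add] at this
    exact this.2 ⟨fun q hq => (hder q hq).differentiableWithinAt, by simp,
      contDiffOn_zero.2 hlip.continuousOn⟩
  refine ⟨u, ⟨hC11, ?_, ?_⟩, ?_⟩
  · intro t ht x
    have h1 : HasFDerivAt (Function.uncurry u) (Φ (x, p (t, x))) (t, x) :=
      (hder (t, x) ⟨Ioo_subset_Icc_self ht, trivial⟩).hasFDerivAt (strip_mem_nhds ht x)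
    have h2 : HasDerivAt (fun s => u s x) (Φ (x, p (t, x)) (1, 0)) t := by
      have := h1.comp_hasDerivAt t ((hasDerivAt_id t).prodMk (hasDerivAt_const t x))
      exact this
    have h3 : HasGradientAt (u t) (p (t, x)) x := by
      rw [hasGradientAt_iff_hasFDerivAt]
      have := h1.comp x (hasFDerivAt_prodMk_right t x)
      refine this.congr_fderiv ?_
      ext
      simp [hΦ]
    rw [h2.deriv, h3.gradient]
    simp [hΦ]
  · intro x
    have h0 : (0 : ℝ) ∈ Icc 0 T := ⟨le_rfl, hT.le⟩
    have h1 := hF.fst_footpoint h0 x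
    rw [hF.init] at h1
    simp only [hu, sub_self, value, hF.action_init]
    exact congrArg G h1
  · intro v hv hvs t ht x
    obtain ⟨Q, hQ⟩ := exists_isLipSolution hv hvs
    -- Characteristics give equality only for 0 < t < T, where the equation holds; continuity
    -- reaches the endpoints.
    have heq : EqOn (fun t => v t x) (fun t => u t x) (Ioo 0 T) := fun t ht =>
      hF.eq_value hex hQ hvs.2 ht x
    have hm : MapsTo (fun t : ℝ => (t, x)) (Icc 0 T) (strip d T) := fun t ht => ⟨ht, trivial⟩
    have hc : ContinuousOn (fun t : ℝ => (t, x)) (Icc 0 T) := Continuous.continuousOn (by fun_prop)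
    exact heq.of_subset_closure (hv.1.continuousOn.comp hc hm) (hC11.1.continuousOn.comp hc hm)
      Ioo_subset_Icc_self (by rw [closure_Ioo hT.ne]) ht

/-! ### Second derivatives along lines -/

section Lines

variable {W : Type*} [NormedAddCommGroup W] [NormedSpace ℝ W]

theorem hasDerivAt_line (y w : W) (t : ℝ) : HasDerivAt (fun t : ℝ => y + t • w) w t := by
  simpa using ((hasDerivAt_id t).smul_const w).const_add y

theorem hasDerivAt_comp_line {f : W → ℝ} (hf : ContDiff ℝ 2 f) (y w : W) (t : ℝ) :
    HasDerivAt (fun t : ℝ => f (y + t • w)) (fderiv ℝ f (y + t • w) w) t :=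
  ((hf.differentiable (by norm_num)) _).hasFDerivAt.comp_hasDerivAt t (hasDerivAt_line y w t)

theorem hasFDerivAt_fderiv {f : W → ℝ} (hf : ContDiff ℝ 2 f) (z : W) :
    HasFDerivAt (fderiv ℝ f) (fderiv ℝ (fderiv ℝ f) z) z :=
  (((hf.fderiv_right (m := 1) (by norm_num)).differentiable (by norm_num)) z).hasFDerivAt

theorem hasDerivAt_fderiv_comp_line {f : W → ℝ} (hf : ContDiff ℝ 2 f) (y w m : W) (t : ℝ) :
    HasDerivAt (fun t : ℝ => fderiv ℝ f (y + t • w) m)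
      (fderiv ℝ (fderiv ℝ f) (y + t • w) w m) t := by
  have h1 := (hasFDerivAt_fderiv hf (y + t • w)).comp_hasDerivAt t (hasDerivAt_line y w t)
  simpa using h1.clm_apply (hasDerivAt_const t m)

/-- The direction m is fixed first, so the scalar mean value theorem applies and one point ζ serves.
Later estimates can then complete squares in a single symmetric form. -/
theorem exists_fderiv_sub_apply_eq {f : W → ℝ} (hf : ContDiff ℝ 2 f) (y z m : W) :
    ∃ ζ, fderiv ℝ f z m - fderiv ℝ f y m = fderiv ℝ (fderiv ℝ f) ζ (z - y) m := by
  obtain ⟨θ, -, hθ⟩ := exists_hasDerivAt_eq_slope (fun t : ℝ => fderiv ℝ f (y + t • (z - y)) m)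
    (fun t => fderiv ℝ (fderiv ℝ f) (y + t • (z - y)) (z - y) m) zero_lt_one
    (fun t _ => (hasDerivAt_fderiv_comp_line hf y (z - y) m t).continuousAt.continuousWithinAt)
    (fun t _ => hasDerivAt_fderiv_comp_line hf y (z - y) m t)
  refine ⟨_, Eq.trans ?_ hθ.symm⟩
  simp

theorem sndDeriv_symm {f : W → ℝ} (hf : ContDiff ℝ 2 f) (z a b : W) :
    fderiv ℝ (fderiv ℝ f) z a b = fderiv ℝ (fderiv ℝ f) z b a :=
  (hf.contDiffAt.isSymmSndFDerivAt (by simp)) a b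

theorem sndDeriv_nonneg_of_convex_line {f : W → ℝ} (hf : ContDiff ℝ 2 f) {y w : W}
    (hc : ConvexOn ℝ univ fun t : ℝ => f (y + t • w)) : 0 ≤ fderiv ℝ (fderiv ℝ f) y w w := by
  have h1 := hc.monotoneOn_deriv fun t _ => (hasDerivAt_comp_line hf y w t).differentiableAt
  have h2 : (deriv fun t : ℝ => f (y + t • w)) = fun t => fderiv ℝ f (y + t • w) w :=
    funext fun t => (hasDerivAt_comp_line hf y w t).deriv
  rw [h2, monotoneOn_univ] at h1
  have h3 := h1.deriv_nonneg (x := 0)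
  rw [(hasDerivAt_fderiv_comp_line hf y w w 0).deriv] at h3
  simpa using h3

theorem convexOn_comp_line {f : W → ℝ} (hf : ConvexOn ℝ univ f) (y w : W) :
    ConvexOn ℝ univ fun t : ℝ => f (y + t • w) := by
  refine ⟨convex_univ, fun s _ t _ a b ha hb hab => ?_⟩
  have h1 := hf.2 (mem_univ (y + s • w)) (mem_univ (y + t • w)) ha hb hab
  have h2 : y + (a • s + b • t) • w = a • (y + s • w) + b • (y + t • w) := by
    have : y = (a + b) • y := by rw [hab, one_smul]
    nth_rewrite 1 [this]
    simp only [smul_eq_mul]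
    module
  simp only [h2]
  exact h1

/-- Only the direction y - x is tested, because H is concave merely along the directions (w, -αw).
-/
theorem concave_combination_of_sndDeriv_nonpos {f : W → ℝ} (hf : ContDiff ℝ 2 f) {x y : W}
    (h : ∀ ζ, fderiv ℝ (fderiv ℝ f) ζ (y - x) (y - x) ≤ 0) {a b : ℝ} (ha : 0 ≤ a) (hb : 0 ≤ b)
    (hab : a + b = 1) : a * f x + b * f y ≤ f (a • x + b • y) := by
  have h2 : (deriv fun t : ℝ => f (x + t • (y - x))) = fun t => fderiv ℝ f (x + t • (y - x)) (y - x) :=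
    funext fun t => (hasDerivAt_comp_line hf x (y - x) t).deriv
  have hc : ConcaveOn ℝ univ fun t : ℝ => f (x + t • (y - x)) := by
    refine concaveOn_univ_of_deriv2_nonpos
      (fun t => (hasDerivAt_comp_line hf x (y - x) t).differentiableAt) ?_ fun t => ?_
    · rw [h2]
      exact fun t => (hasDerivAt_fderiv_comp_line hf x (y - x) (y - x) t).differentiableAt
    · simp only [Function.iterate_succ, Function.iterate_zero, Function.comp_apply, id_eq, h2]
      rw [(hasDerivAt_fderiv_comp_line hf x (y - x) (y - x) t).deriv]
      exact h _
  have h3 := hc.2 (mem_univ 0) (mem_univ 1) ha hb hab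
  have h4 : x + b • (y - x) = a • x + b • y := by
    have : x = (a + b) • x := by rw [hab, one_smul]
    nth_rewrite 1 [this]
    module
  simpa [h4] using h3

theorem abs_sndDeriv_le {f : W → ℝ} {C : ℝ≥0} (hC : LipschitzWith C (fderiv ℝ f)) (z a b : W) :
    |fderiv ℝ (fderiv ℝ f) z a b| ≤ C * ‖a‖ * ‖b‖ := by
  refine ((fderiv ℝ (fderiv ℝ f) z).le_opNorm₂ a b).trans ?_
  gcongr
  exact norm_fderiv_le_of_lipschitz ℝ hC

end Lines

/-! ### Cocoercivity of convex gradients -/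

section Hilbert

variable {V : Type*} [NormedAddCommGroup V] [InnerProductSpace ℝ V]

/-- Cocoercivity of the gradient of a convex function with Lipschitz gradient. -/
theorem cocoercive_of_convex {f : V → ℝ} {C : ℝ≥0} (hf : ContDiff ℝ 2 f)
    (hc : ConvexOn ℝ univ f) (hC : LipschitzWith C (fderiv ℝ f)) {y z w : V}
    (hw : ∀ m, inner ℝ w m = fderiv ℝ f z m - fderiv ℝ f y m) :
    1 / (2 * (C + 1)) * ‖w‖ ^ 2 ≤ inner ℝ w (z - y) := by
  set ε : ℝ := 1 / (C + 1) with hε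
  have hεpos : 0 < ε := by positivity
  -- With a = z - y, B(a, a - εw) is a square minus (ε²/4)B(w, w). The square is nonnegative by
  -- convexity, and ε = 1/(C + 1) keeps the loss below (ε/4)‖w‖².
  obtain ⟨ζ, hζ⟩ := exists_fderiv_sub_apply_eq hf y z (z - y - ε • w)
  rw [← hw] at hζ
  set B := fderiv ℝ (fderiv ℝ f) ζ with hB
  have hsymm : ∀ a b, B a b = B b a := sndDeriv_symm hf ζ
  have h1 : 0 ≤ B (z - y - (ε / 2) • w) (z - y - (ε / 2) • w) :=
    sndDeriv_nonneg_of_convex_line hf (convexOn_comp_line hc _ _)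
  have h2 : B (z - y) (z - y - ε • w) =
      B (z - y - (ε / 2) • w) (z - y - (ε / 2) • w) - ε ^ 2 / 4 * B w w := by
    generalize z - y = a
    simp only [map_sub, map_smul, sub_apply, smul_apply,
      smul_eq_mul, hsymm w a]
    ring
  have h3 : B w w ≤ C * ‖w‖ ^ 2 := by
    calc B w w ≤ |B w w| := le_abs_self _
      _ ≤ C * ‖w‖ * ‖w‖ := abs_sndDeriv_le hC ζ w w
      _ = _ := by ring
  have h4 : ε ^ 2 / 4 * B w w ≤ ε / 4 * ‖w‖ ^ 2 := by
    have h5 : ε * C ≤ 1 := by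
      rw [hε, one_div, inv_mul_le_iff₀ (by positivity)]; linarith
    calc ε ^ 2 / 4 * B w w ≤ ε ^ 2 / 4 * (C * ‖w‖ ^ 2) := by gcongr
      _ = ε / 4 * (ε * C) * ‖w‖ ^ 2 := by ring
      _ ≤ ε / 4 * 1 * ‖w‖ ^ 2 := by gcongr
      _ = _ := by ring
  rw [inner_sub_right, inner_smul_right, real_inner_self_eq_norm_sq, h2] at hζ
  have h6 : 1 / (2 * ((C : ℝ) + 1)) = ε / 2 := by rw [hε]; field_simp
  rw [h6]
  have h7 : 0 ≤ ε * ‖w‖ ^ 2 := by positivity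
  linarith

/-! ### The propagation estimate for concave-convex Hamiltonians -/

/-- Dissipativity of the characteristic field of `h`, whose second derivative is nonnegative on the
momentum directions and nonpositive on the directions `(w, -α w)`. -/
theorem saddle_estimate {h : V × V → ℝ} (hh : ContDiff ℝ 2 h) {C : ℝ≥0} {α ε : ℝ}
    (hC : LipschitzWith C (fderiv ℝ h))
    (hpp : ∀ z w, 0 ≤ fderiv ℝ (fderiv ℝ h) z (0, w) (0, w))
    (hxx : ∀ z w, fderiv ℝ (fderiv ℝ h) z (w, -(α • w)) (w, -(α • w)) ≤ 0)
    (hε0 : 0 ≤ ε) (hε1 : ε ≤ 1) (z z' : V × V) {x w : V} (hx : z.1 - z'.1 = x)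
    (hw : z.2 - z'.2 + α • x = w) :
    -(3 * C * (1 + |α|) ^ 2 * ε * ‖w‖ ^ 2) ≤
      fderiv ℝ h z (((0, w) : V × V) - (x, -(α • x)) + (2 * ε) • (w, -(α • w))) -
      fderiv ℝ h z' (((0, w) : V × V) - (x, -(α • x)) + (2 * ε) • (w, -(α • w))) := by
  obtain ⟨ζ, hζ⟩ := exists_fderiv_sub_apply_eq hh z' z
    (((0, w) : V × V) - (x, -(α • x)) + (2 * ε) • (w, -(α • w)))
  rw [hζ]
  set B := fderiv ℝ (fderiv ℝ h) ζ with hB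
  have hsymm : ∀ a b, B a b = B b a := sndDeriv_symm hh ζ
  have hzz : z - z' = ((x, -(α • x)) : V × V) + (0, w) := by
    refine Prod.ext (by simpa using hx) ?_
    simp [← hw]
  have hdir : ((x, -(α • x)) : V × V) - ε • (w, -(α • w)) =
      (x - ε • w, -(α • (x - ε • w))) := by
    refine Prod.ext rfl ?_
    simp only [Prod.snd_sub, Prod.smul_snd]
    module
  have h1 := hpp ζ w
  have h2 := hxx ζ (x - ε • w)
  rw [← hdir] at h2
  have hb : ‖((w, -(α • w)) : V × V)‖ ≤ (1 + |α|) * ‖w‖ := by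
    rw [Prod.norm_def, norm_neg, norm_smul, Real.norm_eq_abs]
    have h3 := norm_nonneg w
    have h4 : 0 ≤ |α| * ‖w‖ := by positivity
    exact max_le (by simp; linarith) (by linarith)
  have hq : ‖((0, w) : V × V)‖ ≤ (1 + |α|) * ‖w‖ := by
    rw [Prod.norm_def]
    have h3 := norm_nonneg w
    have h4 : 0 ≤ |α| * ‖w‖ := by positivity
    exact max_le (by simp; positivity) (by simp; linarith)
  rw [hzz]
  generalize ((w, -(α • w)) : V × V) = b at *
  generalize ((x, -(α • x)) : V × V) = a at *
  generalize ((0, w) : V × V) = q at *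
  have hbb : -(C * (1 + |α|) ^ 2 * ‖w‖ ^ 2) ≤ B b b := by
    refine (abs_le.1 ?_).1
    calc |B b b| ≤ C * ‖b‖ * ‖b‖ := abs_sndDeriv_le hC ζ b b
      _ ≤ C * ((1 + |α|) * ‖w‖) * ((1 + |α|) * ‖w‖) := by gcongr
      _ = _ := by ring
  have hqb : -(C * (1 + |α|) ^ 2 * ‖w‖ ^ 2) ≤ B q b := by
    refine (abs_le.1 ?_).1
    calc |B q b| ≤ C * ‖q‖ * ‖b‖ := abs_sndDeriv_le hC ζ q b
      _ ≤ C * ((1 + |α|) * ‖w‖) * ((1 + |α|) * ‖w‖) := by gcongr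
      _ = _ := by ring
  -- Completing the square absorbs B(a, b) into a - εb, again of the form (·, -α ·), where B is
  -- nonpositive. The remaining terms are O(ε‖w‖²) and do not involve x.
  have hid : B (a + q) (q - a + (2 * ε) • b) =
      B q q - B (a - ε • b) (a - ε • b) + ε ^ 2 * B b b + 2 * ε * B q b := by
    simp only [map_sub, map_add, map_smul, sub_apply,
      add_apply, smul_apply, smul_eq_mul, hsymm b a,
      hsymm q a]
    ring
  rw [hid]
  set D : ℝ := C * (1 + |α|) ^ 2 * ‖w‖ ^ 2 with hD
  have hD0 : 0 ≤ D := by positivity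
  have e1 : -(ε * D) ≤ ε ^ 2 * B b b := by
    have : ε ^ 2 * -D ≤ ε ^ 2 * B b b := by gcongr
    have h5 : ε ^ 2 * D ≤ ε * D := by gcongr; nlinarith
    linarith
  have e2 : 2 * ε * -D ≤ 2 * ε * B q b := by gcongr
  have e3 : 3 * C * (1 + |α|) ^ 2 * ε * ‖w‖ ^ 2 = 3 * (ε * D) := by rw [hD]; ring
  rw [e3]
  linarith

/-- Along the characteristics of a Hamiltonian that is concave-convex after the shift by `α`,
cocoercivity of the shifted momentum propagates. -/
theorem momentum_estimate {h : V × V → ℝ} (hh : ContDiff ℝ 2 h) {C M : ℝ≥0} {α ε₀ : ℝ}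
    {hx hp : V × V → V} (hH : IsLipHamiltonian h hx hp M)
    (hC : LipschitzWith C (fderiv ℝ h))
    (hpp : ∀ z w, 0 ≤ fderiv ℝ (fderiv ℝ h) z (0, w) (0, w))
    (hxx : ∀ z w, fderiv ℝ (fderiv ℝ h) z (w, -(α • w)) (w, -(α • w)) ≤ 0)
    (hε0 : 0 < ε₀) (hε1 : ε₀ ≤ 1) {γ γ' : ℝ → V × V} (hγ : IsCharacteristic hx hp γ)
    (hγ' : IsCharacteristic hx hp γ')
    (hinit : ε₀ * ‖((γ 0).2 - (γ' 0).2) + α • ((γ 0).1 - (γ' 0).1)‖ ^ 2 ≤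
      inner ℝ (((γ 0).2 - (γ' 0).2) + α • ((γ 0).1 - (γ' 0).1)) ((γ 0).1 - (γ' 0).1))
    {T s : ℝ} (hs : s ∈ Icc 0 T) :
    ‖(γ s).2 - (γ' s).2‖ ≤
      (1 + |α| + Real.exp (3 * C * (1 + |α|) ^ 2 * T) / ε₀) * ‖(γ s).1 - (γ' s).1‖ := by
  set Λ : ℝ := 3 * C * (1 + |α|) ^ 2 with hΛ
  have hΛ0 : 0 ≤ Λ := by positivity
  set x : ℝ → V := fun s => (γ s).1 - (γ' s).1 with hxdef
  set w : ℝ → V := fun s => ((γ s).2 - (γ' s).2) + α • x s with hwdef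
  -- The decay rate Λ of ε contributes Λε‖w‖² to Θ', exactly the loss in `saddle_estimate`.
  set ε : ℝ → ℝ := fun s => ε₀ * Real.exp (-(Λ * s)) with hεdef
  have hε' : ∀ s, HasDerivAt ε (-(Λ * ε s)) s := fun s => by
    have h1 : HasDerivAt (fun s : ℝ => -(Λ * s)) (-Λ) s := by
      simpa [Pi.neg_def] using ((hasDerivAt_id s).const_mul Λ).neg
    refine (h1.exp.const_mul ε₀).congr_deriv ?_
    simp only [hεdef]; ring
  have hx' : ∀ s, HasDerivAt x (hp (γ s) - hp (γ' s)) s := fun s =>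
    (hγ.hasDerivAt_fst s).sub (hγ'.hasDerivAt_fst s)
  have hw' : ∀ s, HasDerivAt w ((-hx (γ s) - -hx (γ' s)) + α • (hp (γ s) - hp (γ' s))) s :=
    fun s => ((hγ.hasDerivAt_snd s).sub (hγ'.hasDerivAt_snd s)).add ((hx' s).const_smul α)
  set Θ : ℝ → ℝ := fun s => inner ℝ (w s) (x s) - ε s * inner ℝ (w s) (w s) with hΘdef
  have hΘ' : ∀ s, HasDerivAt Θ ((inner ℝ (w s) (hp (γ s) - hp (γ' s)) +
      inner ℝ ((-hx (γ s) - -hx (γ' s)) + α • (hp (γ s) - hp (γ' s))) (x s)) -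
      (-(Λ * ε s) * inner ℝ (w s) (w s) + ε s *
        (inner ℝ (w s) ((-hx (γ s) - -hx (γ' s)) + α • (hp (γ s) - hp (γ' s))) +
         inner ℝ ((-hx (γ s) - -hx (γ' s)) + α • (hp (γ s) - hp (γ' s))) (w s)))) s := fun s =>
    ((hw' s).inner ℝ (hx' s)).sub ((hε' s).mul ((hw' s).inner ℝ (hw' s)))
  have hmono : MonotoneOn Θ (Ici 0) := by
    refine monotoneOn_of_hasDerivWithinAt_nonneg (convex_Ici 0)
      (fun s _ => (hΘ' s).continuousAt.continuousWithinAt)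
      (fun s _ => (hΘ' s).hasDerivWithinAt) fun s hs => ?_
    rw [interior_Ici, mem_Ioi] at hs
    have h1 : ε s ≤ 1 := by
      have : Real.exp (-(Λ * s)) ≤ 1 := Real.exp_le_one_iff.2 (by simp; positivity)
      calc ε s ≤ 1 * 1 := mul_le_mul hε1 this (Real.exp_pos _).le zero_le_one
        _ = 1 := one_mul 1
    have h2 := saddle_estimate hh hC hpp hxx (ε := ε s) (by positivity) h1 (γ s) (γ' s)
      (x := x s) (w := w s) rfl rfl
    rw [(hH.hasFDerivAt (γ s)).fderiv, (hH.hasFDerivAt (γ' s)).fderiv] at h2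
    simp only [pairForm_apply, Prod.fst_add, Prod.snd_add, Prod.fst_sub, Prod.snd_sub,
      Prod.smul_fst, Prod.smul_snd, zero_sub, sub_neg_eq_add, inner_add_right, inner_neg_right,
      inner_smul_right] at h2
    simp only [inner_add_left, inner_add_right, inner_sub_left, inner_sub_right, inner_neg_left,
      inner_neg_right, inner_smul_left, inner_smul_right, real_inner_self_eq_norm_sq, RCLike.conj_to_real,
      real_inner_comm (hp (γ s)) (w s), real_inner_comm (hp (γ' s)) (w s),
      real_inner_comm (hx (γ s)) (w s), real_inner_comm (hx (γ' s)) (w s)]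
    linarith
  have h0 : 0 ≤ Θ 0 := by
    simp only [hΘdef, hεdef, mul_zero, neg_zero, Real.exp_zero, mul_one,
      real_inner_self_eq_norm_sq]
    exact sub_nonneg.2 hinit
  have hΘs : 0 ≤ Θ s := h0.trans (hmono (mem_Ici.2 le_rfl) hs.1 hs.1)
  have hεs : 0 < ε s := by positivity
  have hle : ε s * ‖w s‖ ≤ ‖x s‖ := by
    by_cases hw0 : ‖w s‖ = 0
    · rw [hw0, mul_zero]; exact norm_nonneg _
    have hpos : 0 < ‖w s‖ := lt_of_le_of_ne (norm_nonneg _) (Ne.symm hw0)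
    have h1 := real_inner_le_norm (w s) (x s)
    simp only [hΘdef, real_inner_self_eq_norm_sq] at hΘs
    refine le_of_mul_le_mul_left ?_ hpos
    calc ‖w s‖ * (ε s * ‖w s‖) = ε s * ‖w s‖ ^ 2 := by ring
      _ ≤ ‖w s‖ * ‖x s‖ := by linarith
  have hwle : ‖w s‖ ≤ Real.exp (Λ * T) / ε₀ * ‖x s‖ := by
    have h1 : ‖w s‖ ≤ ‖x s‖ / ε s := by rw [le_div_iff₀ hεs]; linarith
    have h2 : ‖x s‖ / ε s = Real.exp (Λ * s) / ε₀ * ‖x s‖ := by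
      simp only [hεdef, Real.exp_neg]
      field_simp
    rw [h2] at h1
    refine h1.trans ?_
    gcongr
    exact hs.2
  have hpw : (γ s).2 - (γ' s).2 = w s - α • x s := by simp [hwdef]
  rw [hpw]
  calc ‖w s - α • x s‖ ≤ ‖w s‖ + ‖α • x s‖ := norm_sub_le _ _
    _ ≤ Real.exp (Λ * T) / ε₀ * ‖x s‖ + |α| * ‖x s‖ := by
        rw [norm_smul, Real.norm_eq_abs]; gcongr
    _ ≤ _ := by
        have := norm_nonneg (x s)
        linarith

end Hilbert

/-! ### Gradients of functions with bounded second derivative -/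

theorem IsC2Bounded.exists_lipschitz {F : Type*} [NormedAddCommGroup F] [NormedSpace ℝ F]
    {f : F → ℝ} (hf : IsC2Bounded f) : ∃ C : ℝ≥0, LipschitzWith C (fderiv ℝ f) := by
  obtain ⟨C, hC⟩ := hf.2
  refine ⟨C.toNNReal, lipschitzWith_of_nnnorm_fderiv_le
    (fun z => (hasFDerivAt_fderiv hf.1 z).differentiableAt) fun z => ?_⟩
  rw [← NNReal.coe_le_coe, coe_nnnorm]
  exact (hC z).trans (Real.le_coe_toNNReal C)

section Hilbert

variable {V : Type*} [NormedAddCommGroup V] [InnerProductSpace ℝ V]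

theorem exists_isLipHamiltonian [CompleteSpace V] {h : V × V → ℝ} (hh : IsC2Bounded h) :
    ∃ (hx hp : V × V → V) (M : ℝ≥0), IsLipHamiltonian h hx hp M ∧
      ContDiff ℝ 1 hx ∧ ContDiff ℝ 1 hp := by
  obtain ⟨C, hC⟩ := hh.exists_lipschitz
  have hriesz : IsBoundedLinearMap ℝ fun A : V →L[ℝ] ℝ => (InnerProductSpace.toDual ℝ V).symm A :=
    ⟨⟨fun A B => map_add _ A B, fun c A => by simp⟩, 1, zero_lt_one, fun A => by simp⟩
  have hsmooth : ContDiff ℝ 1 (fderiv ℝ h) := hh.1.fderiv_right (by norm_num)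
  have hlip : ∀ ι : V →L[ℝ] V × V, ‖ι‖ ≤ 1 → LipschitzWith C fun z =>
      (InnerProductSpace.toDual ℝ V).symm ((fderiv ℝ h z).comp ι) := by
    intro ι hι
    refine LipschitzWith.of_dist_le_mul fun z z' => ?_
    rw [LinearIsometryEquiv.dist_map, dist_eq_norm, ← ContinuousLinearMap.sub_comp]
    refine (ContinuousLinearMap.opNorm_comp_le _ _).trans ?_
    refine (mul_le_of_le_one_right (norm_nonneg _) hι).trans ?_
    rw [← dist_eq_norm]
    exact hC.dist_le_mul z z'
  refine ⟨fun z => (InnerProductSpace.toDual ℝ V).symm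
      ((fderiv ℝ h z).comp (ContinuousLinearMap.inl ℝ V V)),
    fun z => (InnerProductSpace.toDual ℝ V).symm
      ((fderiv ℝ h z).comp (ContinuousLinearMap.inr ℝ V V)), C,
    ⟨fun z => ?_, hlip _ (ContinuousLinearMap.norm_inl_le_one ℝ V V),
      hlip _ (ContinuousLinearMap.norm_inr_le_one ℝ V V)⟩, ?_, ?_⟩
  · refine ((hh.1.differentiable (by norm_num)) z).hasFDerivAt.congr_fderiv ?_
    ext w <;> simp
  · exact hriesz.contDiff.comp (hsmooth.clm_comp contDiff_const)
  · exact hriesz.contDiff.comp (hsmooth.clm_comp contDiff_const)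

theorem exists_gradient [CompleteSpace V] {G : V → ℝ} (hG : IsC2Bounded G) :
    ∃ (g : V → V) (N : ℝ≥0), (∀ y, HasFDerivAt G (innerSL ℝ (g y)) y) ∧ LipschitzWith N g := by
  obtain ⟨C, hC⟩ := hG.exists_lipschitz
  refine ⟨fun y => (InnerProductSpace.toDual ℝ V).symm (fderiv ℝ G y), C, fun y => ?_, ?_⟩
  · refine ((hG.1.differentiable (by norm_num)) y).hasFDerivAt.congr_fderiv ?_
    ext w
    simp
  · refine LipschitzWith.of_dist_le_mul fun z z' => ?_
    rw [LinearIsometryEquiv.dist_map]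
    exact hC.dist_le_mul z z'

theorem exists_characteristic [CompleteSpace V] {h : V × V → ℝ} {hx hp : V × V → V} {M : ℝ≥0}
    (hh : IsLipHamiltonian h hx hp M) (hxs : ContDiff ℝ 1 hx) (hps : ContDiff ℝ 1 hp) (z : V × V) :
    ∃ γ, γ 0 = z ∧ IsCharacteristic hx hp γ :=
  exists_global_integralCurve hh.lipschitz_field (hps.prodMk hxs.neg) z

/-! ### Strict convexity of a conjugate function -/

/-- The supremum defining a conjugate function is attained at the gradient. -/
theorem conjugate_attained {k φ : V → ℝ} (hφ : Continuous φ)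
    (hlub : ∀ p, IsLUB (range fun v => inner ℝ p v - φ v) (k p)) {p κ : V} {C : ℝ} (hC : 0 ≤ C)
    (hrem : ∀ η, k (p + η) - k p - inner ℝ κ η ≤ C * ‖η‖ ^ 2) : inner ℝ p κ - φ κ = k p := by
  refine le_antisymm ((hlub p).1 ⟨κ, rfl⟩) ?_
  have hex : ∀ n : ℕ, ∃ v, k p - 1 / ((n : ℝ) + 1) < inner ℝ p v - φ v := fun n => by
    have : k p - 1 / ((n : ℝ) + 1) < k p := sub_lt_self _ (by positivity)
    obtain ⟨_, ⟨v, rfl⟩, hv, -⟩ := (hlub p).exists_between this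
    exact ⟨v, hv⟩
  choose v hv using hex
  have hnorm : ∀ n, ‖v n - κ‖ ^ 2 ≤ 4 * (C + 1) * (1 / ((n : ℝ) + 1)) := by
    intro n
    -- Testing the supremum at p + r(vₙ - κ) gains r‖vₙ - κ‖² against a quadratic error at most half
    -- of it. Near-maximisers therefore converge to κ, without compactness.
    set r : ℝ := 1 / (2 * (C + 1)) with hr
    have hr0 : 0 < r := by positivity
    have h1 := (hlub (p + r • (v n - κ))).1 ⟨v n, rfl⟩
    have h2 := hrem (r • (v n - κ))
    simp only [inner_add_left, inner_smul_left, RCLike.conj_to_real, inner_smul_right, norm_smul,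
      Real.norm_of_nonneg hr0.le] at h1 h2
    have h3 : inner ℝ (v n - κ) (v n) - inner ℝ κ (v n - κ) = ‖v n - κ‖ ^ 2 := by
      rw [← real_inner_self_eq_norm_sq, real_inner_comm (v n - κ) κ, ← inner_sub_right]
    have h4 := hv n
    have h5 : r * ‖v n - κ‖ ^ 2 ≤ 1 / ((n : ℝ) + 1) + C * (r * ‖v n - κ‖) ^ 2 := by
      rw [← h3, mul_sub]; linarith
    have h6 : C * (r * ‖v n - κ‖) ^ 2 ≤ r / 2 * ‖v n - κ‖ ^ 2 := by
      have h7 : C * r ≤ 1 / 2 := by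
        rw [hr, mul_one_div, div_le_div_iff₀ (by positivity) (by norm_num)]; linarith
      calc C * (r * ‖v n - κ‖) ^ 2 = C * r * r * ‖v n - κ‖ ^ 2 := by ring
        _ ≤ 1 / 2 * r * ‖v n - κ‖ ^ 2 := by gcongr
        _ = _ := by ring
    have h8 : r / 2 * ‖v n - κ‖ ^ 2 ≤ 1 / ((n : ℝ) + 1) := by linarith
    have h9 : 4 * (C + 1) * (r / 2 * ‖v n - κ‖ ^ 2) = ‖v n - κ‖ ^ 2 := by
      rw [hr]; field_simp; ring
    rw [← h9]
    gcongr
  have hlim : Tendsto v atTop (𝓝 κ) := by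
    rw [tendsto_iff_norm_sub_tendsto_zero]
    have h1 : Tendsto (fun n : ℕ => 4 * (C + 1) * (1 / ((n : ℝ) + 1))) atTop (𝓝 0) := by
      simpa using tendsto_one_div_add_atTop_nhds_zero_nat.const_mul (4 * (C + 1))
    have h2 : Tendsto (fun n => ‖v n - κ‖ ^ 2) atTop (𝓝 0) :=
      squeeze_zero (fun n => by positivity) hnorm h1
    have h3 := h2.sqrt
    simpa [Real.sqrt_sq (norm_nonneg _)] using h3
  have h1 : Tendsto (fun n => inner ℝ p (v n) - φ (v n)) atTop (𝓝 (inner ℝ p κ - φ κ)) := by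
    have hc : Continuous fun v => inner ℝ p v - φ v := by fun_prop
    exact (hc.tendsto κ).comp hlim
  have h2 : Tendsto (fun n : ℕ => k p - 1 / ((n : ℝ) + 1)) atTop (𝓝 (k p)) := by
    simpa using tendsto_one_div_add_atTop_nhds_zero_nat.const_sub (k p)
  exact le_of_tendsto_of_tendsto' h2 h1 fun n => (hv n).le

theorem convexOn_of_isLUB {k φ : V → ℝ}
    (hlub : ∀ p, IsLUB (range fun v => inner ℝ p v - φ v) (k p)) : ConvexOn ℝ univ k := by
  refine ⟨convex_univ, fun p _ q _ a b ha hb hab => (hlub _).2 ?_⟩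
  rintro _ ⟨v, rfl⟩
  have h1 := (hlub p).1 ⟨v, rfl⟩
  have h2 := (hlub q).1 ⟨v, rfl⟩
  simp only [inner_add_left, inner_smul_left, RCLike.conj_to_real, smul_eq_mul] at h1 h2 ⊢
  calc a * inner ℝ p v + b * inner ℝ q v - φ v
      = a * (inner ℝ p v - φ v) + b * (inner ℝ q v - φ v) := by
        linear_combination hab * φ v
    _ ≤ a * k p + b * k q := by gcongr

/-- If `h(x, ·)` is the conjugate of a `C²` function, then `∂ₚₚ h` is positive definite. -/
theorem sndDeriv_momentum_pos {h : V × V → ℝ} (hh : ContDiff ℝ 2 h) {hx hp : V × V → V} {M : ℝ≥0}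
    (hH : IsLipHamiltonian h hx hp M) (hps : ContDiff ℝ 1 hp) {x : V} {φ : V → ℝ}
    (hφ : ContDiff ℝ 2 φ) (hlub : ∀ p, IsLUB (range fun v => inner ℝ p v - φ v) (h (x, p)))
    (p : V) {w : V} (hw : w ≠ 0) : 0 < fderiv ℝ (fderiv ℝ h) (x, p) (0, w) (0, w) := by
  set B := fderiv ℝ (fderiv ℝ h) (x, p) with hB
  have hsymm : ∀ a b, B a b = B b a := sndDeriv_symm hh (x, p)
  have hnonneg : ∀ η : V, 0 ≤ B (0, η) (0, η) := by
    intro η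
    refine sndDeriv_nonneg_of_convex_line hh ?_
    have := convexOn_comp_line (convexOn_of_isLUB hlub) p η
    convert this using 3 with t
    simp
  refine lt_of_le_of_ne (hnonneg w) fun h0 => hw ?_
  -- Fermat's rule at the maximiser gives q = ∇φ(∂ₚh(x, q)). If w were null for ∂ₚₚh,
  -- differentiating this identity along w would give w = D²φ · 0 = 0.
  have hgrad : ∀ q, innerSL ℝ q = fderiv ℝ φ (hp (x, q)) := by
    intro q
    have hatt := conjugate_attained (C := 2 * M) (κ := hp (x, q)) hφ.continuous hlub (p := q)
      (by positivity) fun η => by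
        have h1 := hH.remainder (x, q) (x, q + η)
        have h2 : ‖((x, q + η) : V × V) - (x, q)‖ = ‖η‖ := by simp [Prod.norm_def]
        rw [h2] at h1
        simpa using (abs_le.1 h1).2
    have hmax : IsLocalMax (fun v => inner ℝ q v - φ v) (hp (x, q)) :=
      Eventually.of_forall fun v => by
        simp only [hatt]
        exact (hlub q).1 ⟨v, rfl⟩
    have hder : HasFDerivAt (fun v => inner ℝ q v - φ v) (innerSL ℝ q - fderiv ℝ φ (hp (x, q)))
        (hp (x, q)) :=
      (innerSL ℝ q).hasFDerivAt.sub ((hφ.differentiable (by norm_num)) _).hasFDerivAt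
    exact sub_eq_zero.1 (hmax.hasFDerivAt_eq_zero hder)
  have hnull : ∀ η : V, B (0, w) (0, η) = 0 := by
    intro η
    by_contra hne
    -- With this t the form at η + tw equals -1, contradicting nonnegativity.
    set t : ℝ := -(B (0, η) (0, η) + 1) / (2 * B (0, w) (0, η)) with ht
    have h1 := hnonneg (η + t • w)
    have h2 : ((0, η + t • w) : V × V) = (0, η) + t • (0, w) := by simp
    have h3 : 2 * t * B (0, w) (0, η) = -(B (0, η) (0, η) + 1) := by
      rw [ht]; field_simp
    rw [h2] at h1
    simp only [map_add, map_smul, add_apply, smul_apply, smul_eq_mul,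
      hsymm (0, η) (0, w), ← h0] at h1
    linarith
  have hline : HasDerivAt (fun t : ℝ => ((x, p + t • w) : V × V)) (0, w) 0 :=
    (hasDerivAt_const 0 x).prodMk (hasDerivAt_line p w 0)
  have hκ : HasDerivAt (fun t : ℝ => hp (x, p + t • w)) (fderiv ℝ hp (x, p) (0, w)) 0 := by
    have h1 : HasFDerivAt hp (fderiv ℝ hp (x, p)) (x, p + (0 : ℝ) • w) := by
      simpa using ((hps.differentiable (by norm_num)) (x, p)).hasFDerivAt
    exact h1.comp_hasDerivAt 0 hline
  have hκ0 : fderiv ℝ hp (x, p) (0, w) = 0 := by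
    refine ext_inner_right ℝ fun η => ?_
    have h1 : HasDerivAt (fun t : ℝ => inner ℝ (hp (x, p + t • w)) η)
        (inner ℝ (fderiv ℝ hp (x, p) (0, w)) η) 0 := by
      simpa using hκ.inner ℝ (hasDerivAt_const 0 η)
    have h2 := hasDerivAt_fderiv_comp_line hh (x, p) (0, w) (0, η) 0
    have h3 : (fun t : ℝ => fderiv ℝ h ((x, p) + t • (0, w)) (0, η)) =
        fun t : ℝ => inner ℝ (hp (x, p + t • w)) η := by
      funext t
      rw [(hH.hasFDerivAt _).fderiv]
      simp
    rw [h3] at h2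
    have h4 := h1.unique h2
    rw [h4, inner_zero_left]
    simpa using hnull η
  rw [hκ0] at hκ
  have h1 : HasDerivAt (fun t : ℝ => innerSL ℝ (p + t • w)) (innerSL ℝ w) 0 :=
    (innerSL ℝ).hasFDerivAt.comp_hasDerivAt 0 (hasDerivAt_line p w 0)
  have h2 : HasDerivAt (fun t : ℝ => innerSL ℝ (p + t • w)) (0 : V →L[ℝ] ℝ) 0 := by
    have h3 := (hasFDerivAt_fderiv hφ (hp (x, p + (0 : ℝ) • w))).comp_hasDerivAt 0 hκ
    rw [map_zero] at h3
    have h4 : (fun t : ℝ => innerSL ℝ (p + t • w)) = fderiv ℝ φ ∘ fun t : ℝ => hp (x, p + t • w) :=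
      funext fun t => hgrad _
    rw [h4]
    exact h3
  have h3 := h1.unique h2
  have h4 := innerSL_apply_norm (𝕜 := ℝ) w
  rw [h3, norm_zero] at h4
  exact norm_eq_zero.1 h4.symm

end Hilbert

/-! ### Quadratic forms of the second derivative -/

theorem quad_of_bilin (b : E d →L[ℝ] E d →L[ℝ] ℝ) (w : E d) :
    quad (Matrix.of fun i j => b (stdVec i) (stdVec j)) w = b w w := by
  have hw : w = ∑ i, w i • stdVec i := by
    have := (EuclideanSpace.basisFun (Fin d) ℝ).sum_repr w
    simpa [stdVec] using this.symm
  conv_rhs => rw [hw]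
  simp only [quad, Matrix.mulVec, dotProduct, Matrix.of_apply, map_sum, map_smul,
    sum_apply, smul_apply, smul_eq_mul, Finset.mul_sum]
  rw [Finset.sum_comm]
  refine Finset.sum_congr rfl fun i _ => Finset.sum_congr rfl fun j _ => ?_
  ring

theorem quad_symPart (A : Matrix (Fin d) (Fin d) ℝ) (w : E d) : quad (symPart A) w = quad A w := by
  have h1 : w.ofLp ⬝ᵥ (Aᵀ *ᵥ w.ofLp) = w.ofLp ⬝ᵥ (A *ᵥ w.ofLp) := by
    rw [Matrix.mulVec_transpose, dotProduct_comm, Matrix.dotProduct_mulVec]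
  simp only [quad, symPart, Matrix.smul_mulVec, Matrix.add_mulVec, dotProduct_smul, dotProduct_add,
    h1, smul_eq_mul]
  ring

theorem quad_hessXX (H : E d → E d → ℝ) (x p w : E d) :
    quad (hessXX H x p) w = secondDeriv H x p (w, 0) (w, 0) :=
  quad_of_bilin ((secondDeriv H x p).bilinearComp (.inl ℝ _ _) (.inl ℝ _ _)) w

theorem quad_hessXP (H : E d → E d → ℝ) (x p w : E d) :
    quad (hessXP H x p) w = secondDeriv H x p (w, 0) (0, w) :=
  quad_of_bilin ((secondDeriv H x p).bilinearComp (.inl ℝ _ _) (.inr ℝ _ _)) w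

theorem quad_hessPP (H : E d → E d → ℝ) (x p w : E d) :
    quad (hessPP H x p) w = secondDeriv H x p (0, w) (0, w) :=
  quad_of_bilin ((secondDeriv H x p).bilinearComp (.inr ℝ _ _) (.inr ℝ _ _)) w

/-- A number between the two roots makes the second derivative nonpositive on the directions
`(w, -α w)`. -/
theorem sndDeriv_shifted_nonpos {H : E d → E d → ℝ} (hH : ContDiff ℝ 2 (Function.uncurry H)) {α : ℝ}
    (hdisc : ∀ w x p : E d, 0 ≤ disc H x p w)
    (hlarge : ∀ x p w : E d, ‖w‖ = 1 → α ≤ largerRoot H x p w)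
    (hsmall : ∀ x p w : E d, ‖w‖ = 1 → smallerRoot H x p w ≤ α)
    (hpos : ∀ x p w : E d, w ≠ 0 → 0 < secondDeriv H x p (0, w) (0, w)) (z : E d × E d) (w : E d) :
    fderiv ℝ (fderiv ℝ (Function.uncurry H)) z (w, -(α • w)) (w, -(α • w)) ≤ 0 := by
  obtain ⟨x, p⟩ := z
  change secondDeriv H x p _ _ ≤ 0
  have hunit : ∀ e : E d, ‖e‖ = 1 → secondDeriv H x p (e, -(α • e)) (e, -(α • e)) ≤ 0 := by
    intro e he
    have he0 : e ≠ 0 := by rintro rfl; simp at he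
    have hc := hpos x p e he0
    have h1 := hlarge x p e he
    have h2 := hsmall x p e he
    have hD := hdisc e x p
    rw [largerRoot, le_div_iff₀ (by rw [quad_hessPP]; exact hc)] at h1
    rw [smallerRoot, div_le_iff₀ (by rw [quad_hessPP]; exact hc)] at h2
    have hsq := Real.sq_sqrt hD
    -- Lying between the roots means |αc - a| ≤ √(a² - bc). Squaring gives c(b - 2αa + α²c) ≤ 0, and
    -- c > 0 is divided out.
    have habs : (α * quad (hessPP H x p) e - quad (symPart (hessXP H x p)) e) ^ 2 ≤
        disc H x p e := by
      rw [← hsq]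
      exact sq_le_sq' (by linarith) (by linarith)
    rw [disc, quad_symPart, quad_hessPP, quad_hessXP, quad_hessXX] at habs
    have hsymm : secondDeriv H x p (0, e) (e, 0) = secondDeriv H x p (e, 0) (0, e) :=
      sndDeriv_symm hH (x, p) _ _
    have hdec : ((e, -(α • e)) : E d × E d) = (e, 0) - α • (0, e) := by simp
    have hexp : secondDeriv H x p (e, -(α • e)) (e, -(α • e)) =
        secondDeriv H x p (e, 0) (e, 0) - 2 * α * secondDeriv H x p (e, 0) (0, e) +
          α ^ 2 * secondDeriv H x p (0, e) (0, e) := by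
      rw [hdec]
      simp only [map_sub, map_smul, sub_apply, smul_apply, smul_eq_mul, hsymm]
      ring
    rw [hexp]
    refine nonpos_of_mul_nonpos_right ?_ hc
    nlinarith
  by_cases hw : w = 0
  · have h0 : ((w, -(α • w)) : E d × E d) = 0 := by simp [hw]
    rw [h0, map_zero]
  have hn : 0 < ‖w‖ := norm_pos_iff.2 hw
  have h1 := hunit (‖w‖⁻¹ • w) (by rw [norm_smul, norm_inv, norm_norm, inv_mul_cancel₀ hn.ne'])
  have h2 : ((‖w‖⁻¹ • w, -(α • ‖w‖⁻¹ • w)) : E d × E d) = ‖w‖⁻¹ • (w, -(α • w)) := by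
    rw [Prod.smul_mk, smul_neg, smul_comm α]
  rw [h2] at h1
  simp only [map_smul, smul_apply, smul_eq_mul] at h1
  have h3 : 0 < ‖w‖⁻¹ := by positivity
  exact nonpos_of_mul_nonpos_right (nonpos_of_mul_nonpos_right h1 h3) h3

/-! ### Global well-posedness -/

/-- Global well-posedness for Hamiltonians that are concave-convex after a shift by `α`. -/
theorem globallyWellPosed_of_saddle {H : E d → E d → ℝ} {G : E d → ℝ} {α : ℝ}
    (hH : IsC2Bounded (Function.uncurry H)) (hG : IsC2Bounded G)
    (hpp : ∀ z w, 0 ≤ fderiv ℝ (fderiv ℝ (Function.uncurry H)) z (0, w) (0, w))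
    (hxx : ∀ z w, fderiv ℝ (fderiv ℝ (Function.uncurry H)) z (w, -(α • w)) (w, -(α • w)) ≤ 0)
    (hGα : ConvexOn ℝ univ (transG G α)) : GloballyWellPosed H G := by
  intro T hT
  obtain ⟨hx, hp, M, hham, hxs, hps⟩ := exists_isLipHamiltonian hH
  obtain ⟨g, N, hg, hgl⟩ := exists_gradient hG
  obtain ⟨C, hC⟩ := hH.exists_lipschitz
  have hex := exists_characteristic hham hxs hps
  choose Φ hΦ0 hΦ using hex
  set Γ : E d → ℝ → E d × E d := fun y => Φ (y, g y) with hΓ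
  set S : E d → ℝ → ℝ := fun y s => G y +
    ∫ τ in (0 : ℝ)..s, (inner ℝ (Γ y τ).2 (hp (Γ y τ)) - Function.uncurry H (Γ y τ)) with hS
  have hderG : ∀ y, HasFDerivAt (transG G α) (innerSL ℝ (g y + α • y)) y := by
    intro y
    have h1 := (hg y).add ((hasStrictFDerivAt_norm_sq y).hasFDerivAt.const_mul (α / 2))
    refine h1.congr_fderiv ?_
    ext w
    simp
    ring
  have hGs : ContDiff ℝ 2 (transG G α) := hG.1.add (contDiff_const.mul (contDiff_norm_sq ℝ))
  have hGl : LipschitzWith (N + ‖α‖₊) (fderiv ℝ (transG G α)) := by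
    refine LipschitzWith.of_dist_le_mul fun y y' => ?_
    rw [(hderG y).fderiv, (hderG y').fderiv, dist_eq_norm, ← map_sub, innerSL_apply_norm,
      dist_eq_norm]
    have h1 := hgl.norm_sub_le y y'
    have h2 : g y + α • y - (g y' + α • y') = (g y - g y') + α • (y - y') := by module
    rw [h2]
    refine (norm_add_le _ _).trans ?_
    rw [norm_smul]
    push_cast
    linarith
  -- The cocoercivity constant of ∇G_α, whose Lipschitz constant is at most N + |α|.
  set ε₀ : ℝ := 1 / (2 * (((N + ‖α‖₊ : ℝ≥0) : ℝ) + 1)) with hε₀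
  have hε0 : 0 < ε₀ := by positivity
  have hε1 : ε₀ ≤ 1 := by
    rw [hε₀, div_le_one (by positivity)]
    linarith [(N + ‖α‖₊).coe_nonneg]
  have hest : ∀ s ∈ Icc 0 T, ∀ y y', ‖(Γ y s).2 - (Γ y' s).2‖ ≤
      (1 + |α| + Real.exp (3 * C * (1 + |α|) ^ 2 * T) / ε₀) * ‖(Γ y s).1 - (Γ y' s).1‖ := by
    intro s hs y y'
    refine momentum_estimate hH.1 hham hC hpp hxx hε0 hε1 (hΦ (y, g y)) (hΦ (y', g y')) ?_ hs
    simp only [hΦ0]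
    refine cocoercive_of_convex hGs hGα hGl fun m => ?_
    rw [(hderG y).fderiv, (hderG y').fderiv]
    simp only [innerSL_apply_apply, inner_add_left, inner_sub_left, inner_smul_left]
    simp
    ring
  have hfield : IsCharField (Function.uncurry H) hx hp M G g N T
      (1 + |α| + Real.exp (3 * C * (1 + |α|) ^ 2 * T) / ε₀) Γ S :=
    { toIsLipHamiltonian := hham
      hasFDerivAt_init := hg
      lip_g := hgl
      init := fun y => hΦ0 _
      char := fun y => hΦ _
      action_init := fun y => by simp [hS]
      action_deriv := fun y s => by
        have hc : Continuous fun τ =>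
            inner ℝ (Γ y τ).2 (hp (Γ y τ)) - Function.uncurry H (Γ y τ) := by
          have h1 : Continuous (Γ y) := (hΦ _).continuous
          have h2 := hps.continuous
          have h3 := hH.1.continuous
          fun_prop
        exact (hc.integral_hasStrictDerivAt 0 s).hasDerivAt.const_add (G y)
      one_le := by
        have h1 : 0 ≤ Real.exp (3 * C * (1 + |α|) ^ 2 * T) / ε₀ := by positivity
        linarith [abs_nonneg α]
      est := hest }
  exact hfield.wellPosed (fun z => ⟨Φ z, hΦ0 z, hΦ z⟩) (hH.1.of_le (by norm_num)) hT

end HJB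

/-! ### The main theorem -/

theorem mainTheorem4 (d : ℕ) (H L : HJB.E d → HJB.E d → ℝ) (G : HJB.E d → ℝ)
    (hH : HJB.IsC2Bounded (Function.uncurry H)) (hG : HJB.IsC2Bounded G)
    (hL : ContDiff ℝ 2 (Function.uncurry L))
    (hLconv : ∀ x, ConvexOn ℝ Set.univ (L x))
    (hHL : HJB.IsHamiltonianOf H L)
    (hdisc : ∀ w x p : HJB.E d, 0 ≤ HJB.disc H x p w)
    (α : ℝ) (hα : (α : EReal) = HJB.infLargerRoot H)
    (hGα : ConvexOn ℝ Set.univ (HJB.transG G α))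
    (hsup : HJB.supSmallerRoot H ≤ (α : EReal)) :
    HJB.GloballyWellPosed H G ∧
      (∀ p, ConcaveOn ℝ Set.univ fun x => HJB.transH H α x p) ∧
      (∀ x, ConvexOn ℝ Set.univ fun p => HJB.transH H α x p) := by
  obtain ⟨hx, hp, M, hham, -, hps⟩ := HJB.exists_isLipHamiltonian hH
  have hconv : ∀ x, ConvexOn ℝ Set.univ (H x) := fun x =>
    HJB.convexOn_of_isLUB (φ := fun v => L x (-v)) (hHL x)
  have hpos : ∀ x p w : HJB.E d, w ≠ 0 → 0 < HJB.secondDeriv H x p (0, w) (0, w) := by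
    intro x p w hw
    have hφ : ContDiff ℝ 2 fun v : HJB.E d => L x (-v) :=
      hL.comp (contDiff_const.prodMk contDiff_neg)
    exact HJB.sndDeriv_momentum_pos hH.1 hham hps hφ (hHL x) p hw
  have hpp : ∀ (z : HJB.E d × HJB.E d) (w : HJB.E d),
      0 ≤ fderiv ℝ (fderiv ℝ (Function.uncurry H)) z (0, w) (0, w) := by
    intro z w
    by_cases hw : w = 0
    · subst hw
      have h0 : ((0, 0) : HJB.E d × HJB.E d) = 0 := rfl
      rw [h0, map_zero]
    · exact (hpos z.1 z.2 w hw).le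
  have hlarge : ∀ x p w : HJB.E d, ‖w‖ = 1 → α ≤ HJB.largerRoot H x p w := by
    intro x p w hw
    have h1 : HJB.infLargerRoot H ≤ (HJB.largerRoot H x p w : EReal) :=
      iInf_le_of_le x (iInf_le_of_le p (iInf_le_of_le w (iInf_le_of_le hw le_rfl)))
    rw [← hα] at h1
    exact EReal.coe_le_coe_iff.1 h1
  have hsmall : ∀ x p w : HJB.E d, ‖w‖ = 1 → HJB.smallerRoot H x p w ≤ α := by
    intro x p w hw
    have h1 : (HJB.smallerRoot H x p w : EReal) ≤ HJB.supSmallerRoot H :=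
      le_iSup_of_le x (le_iSup_of_le p (le_iSup_of_le w (le_iSup_of_le hw le_rfl)))
    exact EReal.coe_le_coe_iff.1 (h1.trans hsup)
  have hxx := HJB.sndDeriv_shifted_nonpos hH.1 hdisc hlarge hsmall hpos
  refine ⟨HJB.globallyWellPosed_of_saddle hH hG hpp hxx hGα, fun p => ?_, fun x => ?_⟩
  · refine ⟨convex_univ, fun x _ y _ a b ha hb hab => ?_⟩
    -- At fixed p the points (x, p - αx) lie on an affine subspace with directions (w, -αw), where
    -- D²H is nonpositive.
    have hdir : ((y, p - α • y) : HJB.E d × HJB.E d) - (x, p - α • x) =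
        (y - x, -(α • (y - x))) := by
      refine Prod.ext rfl ?_
      simp only [Prod.snd_sub]
      module
    have hcomb : a • ((x, p - α • x) : HJB.E d × HJB.E d) + b • (y, p - α • y) =
        (a • x + b • y, p - α • (a • x + b • y)) := by
      refine Prod.ext rfl ?_
      have hp1 : p = (a + b) • p := by rw [hab, one_smul]
      simp only [Prod.snd_add, Prod.smul_snd]
      nth_rewrite 3 [hp1]
      module
    have h1 := HJB.concave_combination_of_sndDeriv_nonpos hH.1 (x := (x, p - α • x))
      (y := (y, p - α • y)) (fun ζ => by rw [hdir]; exact hxx ζ (y - x)) ha hb hab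
    rw [hcomb] at h1
    exact h1
  · refine ⟨convex_univ, fun p _ q _ a b ha hb hab => ?_⟩
    have h1 := (hconv x).2 (Set.mem_univ (p - α • x)) (Set.mem_univ (q - α • x)) ha hb hab
    have h2 : a • (p - α • x) + b • (q - α • x) = a • p + b • q - α • x := by
      have hx1 : x = (a + b) • x := by rw [hab, one_smul]
      nth_rewrite 3 [hx1]
      module
    rw [h2] at h1
    exact h1
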